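/- Let $m\ge 1$ and $0\le i\le 2m-1$ be integers. Let $H$ be the Heisenberg Lie algebra with basis $h_n$, $n\in\mathbb Z$ (and central element acting by $1$), $[h_a,h_b]=a\,\delta_{a+b,0}$, and for $\mu\in\mathbb C$ let $H_\mu=\mathbb C[h_{-1},h_{-2},\dots]\cdot|\mu\rangle$ be its highest weight module with $h_0|\mu\rangle=\mu|\mu\rangle$ and $h_n|\mu\rangle=0$ for $n>0$. Let $$L_{(m),i}=\bigoplus_{n\in\mathbb Z}H_{\frac{2mn+i}{\sqrt{2m}}}$$ be the irreducible modules of the lattice vertex algebra of the rank-one lattice $\mathbb Z l$, $\langle l,l\rangle=2m$. Let $a_n$, $n\in\mathbb Z$, be the modes of the bosonic vertex operator $$\phi_{\sqrt{2m}}(z)=e^{\sqrt{2m}}\,z^{\sqrt{2m}\,h_0}\exp\Big(\sqrt{2m}\sum_{n\ge1}\frac{h_{-n}}{n}z^n\Big)\exp\Big(-\sqrt{2m}\sum_{n\ge1}\frac{h_n}{n}z^{-n}\Big)=\sum_{n\in\mathbb Z}a_nz^{-n-1}$$ on $L_{(m),i}$, where $e^{\sqrt{2m}}:H_\mu\to H_{\mu+\sqrt{2m}}$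 commutes with $h_n$, $n\ne0$, and sends $|\mu\rangle$ to $|\mu+\sqrt{2m}\rangle$. Put $v_p=\big|\tfrac{-p}{\sqrt{2m}}\big\rangle$, so that $v_{-i+2mn}\in L_{(m),i}$ for all $n\in\mathbb Z$. The operators $a_j$ commute pairwise, and $L_{(m),i}$ has a basis labeled by the sequences $(s_j)_{j\in\mathbb Z}$ of non-negative integers with the following properties: 1. there is $n\in\mathbb Z$ such that $s_{-i+2mk-1}=1$ for all $k\ge n$, and $s_j=0$ for all $j\ge -i+2mn-1$ such that $j+i+1$ is not divisible by $2m$; 2. there is $N\in\mathbb Z$ such that $s_j=0$ for all $j<N$; 3. $s_j+s_{j+1}+\dots+s_{j+2m-1}\le 1$ for all $j\in\mathbb Z$. The basis vector labeled by $(s_j)$ is the monomial vector $$\Big(\prod_{j<-i+2mn}a_j^{s_j}\Big)\,v_{-i+2mn},$$ where $n$ is any integer as in property 1; the vector does not depend on the choice of $n$. -/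

import Mathlib

noncomputable section

namespace LatticeVA

/-! ### The Heisenberg algebra and its highest weight modules -/

/-- The underlying space `ℂ[h₋₁, h₋₂, …]·|μ⟩` of the highest weight module `H_μ` of the Heisenberg
algebra; the variable `X n` (`n ≥ 1`) stands for `h₋ₙ` and `1` for the highest weight vector. -/
abbrev FockSpace : Type := MvPolynomial ℕ+ ℂ

/-- The operator `h_n` on `H_μ`: `h₀ = μ`, `h₋ₙ` is multiplication by the variable `X n`, and
`hₙ = n ∂/∂X n` for `n ≥ 1`, so that `[h_a, h_b] = a δ_{a+b,0}`. -/
def heisenberg (μ : ℂ) : ℤ → Module.End ℂ FockSpace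
  | Int.ofNat 0 => μ • LinearMap.id
  | Int.ofNat (n + 1) => ((n + 1 : ℕ) : ℂ) • (MvPolynomial.pderiv n.succPNat).toLinearMap
  | Int.negSucc n => LinearMap.mulLeft ℂ (MvPolynomial.X n.succPNat)

/-- The formal exponential `exp f = ∑ₖ fᵏ / k!` of a power series `f` without constant term
(so that `fᵏ` contributes to the coefficient of `z^r` only for `k ≤ r`). -/
def expSeries {A : Type*} [Ring A] [Algebra ℂ A] (f : PowerSeries A) : PowerSeries A :=
  PowerSeries.mk fun r => ∑ k ∈ Finset.range (r + 1), ((k.factorial : ℂ)⁻¹) • PowerSeries.coeff r (f ^ k)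

/-- The complex number `√(2m)`. -/
def sqrtTwoM (m : ℕ) : ℂ := ((Real.sqrt (2 * m) : ℝ) : ℂ)

/-- `√(2m) ∑_{n ≥ 1} (h₋ₙ / n) zⁿ`, as a power series in `z`. -/
def creationExponent (m : ℕ) (μ : ℂ) : PowerSeries (Module.End ℂ FockSpace) :=
  PowerSeries.mk fun n => if n = 0 then 0 else (sqrtTwoM m / n) • heisenberg μ (-(n : ℤ))

/-- `-√(2m) ∑_{n ≥ 1} (hₙ / n) wⁿ`, as a power series in `w = z⁻¹`. -/
def annihilationExponent (m : ℕ) (μ : ℂ) : PowerSeries (Module.End ℂ FockSpace) :=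
  PowerSeries.mk fun n => if n = 0 then 0 else (-(sqrtTwoM m / n)) • heisenberg μ (n : ℤ)

/-- The coefficient of `z^t` (`t ∈ ℤ`) in `exp(√(2m) ∑_{n ≥ 1} (h₋ₙ / n) zⁿ)`. -/
def creationCoeff (m : ℕ) (μ : ℂ) (t : ℤ) : Module.End ℂ FockSpace :=
  if 0 ≤ t then PowerSeries.coeff t.toNat (expSeries (creationExponent m μ)) else 0

/-- The coefficient of `z^(-s)` (`s ∈ ℕ`) in `exp(-√(2m) ∑_{n ≥ 1} (hₙ / n) z⁻ⁿ)`. -/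
def annihilationCoeff (m : ℕ) (μ : ℂ) (s : ℕ) : Module.End ℂ FockSpace :=
  PowerSeries.coeff s (expSeries (annihilationExponent m μ))

/-! The annihilation part is locally finite, because it lowers the degree given by
`deg h₋ₙ = n`. -/

/-- Span of the monomials of weighted degree at most `d`, where `X n` has degree `n`. -/
def degLE (d : ℤ) : Submodule ℂ FockSpace :=
  Submodule.span ℂ
    {p | ∃ s : ℕ+ →₀ ℕ, ((Finsupp.weight (fun n : ℕ+ => (n : ℕ)) s : ℕ) : ℤ) ≤ d ∧
      p = MvPolynomial.monomial s 1}

theorem degLE_mono {d e : ℤ} (h : d ≤ e) : degLE d ≤ degLE e := by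
  apply Submodule.span_mono
  rintro p ⟨s, hs, rfl⟩
  exact ⟨s, hs.trans h, rfl⟩

theorem degLE_neg {d : ℤ} (h : d < 0) : degLE d = ⊥ := by
  rw [degLE, Submodule.span_eq_bot]
  rintro p ⟨s, hs, rfl⟩
  omega

theorem exists_mem_degLE (p : FockSpace) : ∃ d : ℕ, p ∈ degLE d := by
  induction p using MvPolynomial.induction_on' with
  | monomial s a =>
    refine ⟨Finsupp.weight (fun n : ℕ+ => (n : ℕ)) s, ?_⟩
    have : MvPolynomial.monomial s a = a • (MvPolynomial.monomial s (1 : ℂ)) := by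
      rw [MvPolynomial.smul_monomial]; simp
    rw [this]
    exact Submodule.smul_mem _ _ (Submodule.subset_span ⟨s, le_rfl, rfl⟩)
  | add p q hp hq =>
    obtain ⟨d, hd⟩ := hp
    obtain ⟨e, he⟩ := hq
    refine ⟨max d e, Submodule.add_mem _ (degLE_mono (by simp) hd) (degLE_mono (by simp) he)⟩

theorem heisenberg_lowers (μ : ℂ) (n : ℕ) (d : ℤ) {p : FockSpace} (hp : p ∈ degLE d) :
    heisenberg μ ((n + 1 : ℕ) : ℤ) p ∈ degLE (d - ((n + 1 : ℕ) : ℤ)) := by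
  refine Submodule.span_induction (p := fun p _ =>
    heisenberg μ ((n + 1 : ℕ) : ℤ) p ∈ degLE (d - ((n + 1 : ℕ) : ℤ))) ?_ ?_ ?_ ?_ hp
  · rintro p ⟨s, hs, rfl⟩
    change ((n + 1 : ℕ) : ℂ) • (MvPolynomial.pderiv n.succPNat (MvPolynomial.monomial s (1 : ℂ)))
      ∈ _
    rw [MvPolynomial.pderiv_monomial]
    by_cases h0 : s n.succPNat = 0
    · simp [h0]
    · apply Submodule.smul_mem
      have : MvPolynomial.monomial (s - Finsupp.single n.succPNat 1)
          ((1 : ℂ) * (s n.succPNat : ℂ)) = (s n.succPNat : ℂ) •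
            MvPolynomial.monomial (s - Finsupp.single n.succPNat 1) (1 : ℂ) := by
        rw [MvPolynomial.smul_monomial]; simp
      rw [this]
      apply Submodule.smul_mem
      refine Submodule.subset_span ⟨_, ?_, rfl⟩
      have hle : Finsupp.single n.succPNat 1 ≤ s := by
        rw [Finsupp.single_le_iff]; omega
      have hw := congrArg (Finsupp.weight (fun n : ℕ+ => (n : ℕ))) (tsub_add_cancel_of_le hle)
      rw [map_add, Finsupp.weight_single] at hw
      simp only [Nat.succPNat_coe, smul_eq_mul, one_mul] at hw
      omega
  · simp
  · intro x y _ _ hx hy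
    rw [map_add]
    exact Submodule.add_mem _ hx hy
  · intro a x _ hx
    rw [map_smul]
    exact Submodule.smul_mem _ _ hx

theorem annihilationExponent_pow_lowers (m : ℕ) (μ : ℂ) (k s : ℕ) (d : ℤ) {p : FockSpace}
    (hp : p ∈ degLE d) :
    PowerSeries.coeff s (annihilationExponent m μ ^ k) p ∈ degLE (d - s) := by
  induction k generalizing s with
  | zero =>
    rw [pow_zero, PowerSeries.coeff_one]
    split_ifs with h
    · subst h; simpa using hp
    · simp
  | succ k ih =>
    rw [pow_succ', PowerSeries.coeff_mul, LinearMap.sum_apply]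
    refine Submodule.sum_mem _ fun x hx => ?_
    obtain ⟨a, b⟩ := x
    rw [Finset.HasAntidiagonal.mem_antidiagonal] at hx
    simp only at hx
    rw [Module.End.mul_apply, annihilationExponent, PowerSeries.coeff_mk]
    rcases a with _ | a
    · simp
    · rw [if_neg (Nat.succ_ne_zero a), LinearMap.smul_apply]
      apply Submodule.smul_mem
      have := heisenberg_lowers μ a _ (ih b)
      have e : d - (s : ℤ) = d - (b : ℤ) - ((a + 1 : ℕ) : ℤ) := by
        rw [← hx]; push_cast; ring
      rw [e]
      exact this

theorem annihilationCoeff_eq_zero (m : ℕ) (μ : ℂ) (s d : ℕ) (h : d < s) {p : FockSpace}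
    (hp : p ∈ degLE d) : annihilationCoeff m μ s p = 0 := by
  have : annihilationCoeff m μ s p ∈ degLE ((d : ℤ) - s) := by
    rw [annihilationCoeff, expSeries, PowerSeries.coeff_mk, LinearMap.sum_apply]
    refine Submodule.sum_mem _ fun k _ => ?_
    rw [LinearMap.smul_apply]
    exact Submodule.smul_mem _ _ (annihilationExponent_pow_lowers m μ k s d hp)
  rw [degLE_neg (by omega)] at this
  simpa using this

theorem finite_support (m : ℕ) (μ : ℂ) (t : ℤ) (p : FockSpace) :
    (Function.support fun s : ℕ =>
      creationCoeff m μ (t + s) (annihilationCoeff m μ s p)).Finite := by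
  obtain ⟨d, hd⟩ := exists_mem_degLE p
  refine (Set.finite_Iic d).subset fun s hs => ?_
  by_contra hlt
  apply hs
  simp only [Set.mem_Iic, not_le] at hlt
  simp only [annihilationCoeff_eq_zero m μ s d hlt hd, map_zero]

/-- The coefficient of `z^t` in
`exp(√(2m) ∑_{n ≥ 1} (h₋ₙ / n) zⁿ) exp(-√(2m) ∑_{n ≥ 1} (hₙ / n) z⁻ⁿ)` on `H_μ`; on each vector the
sum is finite. -/
def expProductCoeff (m : ℕ) (μ : ℂ) (t : ℤ) : Module.End ℂ FockSpace where
  toFun p := ∑ᶠ s : ℕ, creationCoeff m μ (t + s) (annihilationCoeff m μ s p)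
  map_add' p q := by
    rw [← finsum_add_distrib (finite_support m μ t p) (finite_support m μ t q)]
    simp only [map_add]
  map_smul' c p := by
    rw [RingHom.id_apply, smul_finsum' c (finite_support m μ t p)]
    simp only [map_smul]

/-! ### The modules of the lattice vertex algebra -/

/-- The module `L_{(m),i} = ⨁_{k ∈ ℤ} H_{(2mk+i)/√(2m)}`; the summand with index `k` is the
Heisenberg module of highest weight `charge m i k`. -/
abbrev LatticeModule (_m _i : ℕ) : Type := ℤ →₀ FockSpace

/-- The highest weight `(2mk+i)/√(2m)` of the `k`-th summand. -/
def charge (m i : ℕ) (k : ℤ) : ℂ := (2 * m * k + i) / sqrtTwoM m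

/-- `√(2m) · (2mk+i)/√(2m) = 2mk+i`, so `z^{√(2m) h₀}` is `z^(2mk+i)` on the `k`-th summand. -/
theorem sqrtTwoM_mul_charge (m i : ℕ) (hm : 0 < m) (k : ℤ) :
    sqrtTwoM m * charge m i k = ((2 * m * k + i : ℤ) : ℂ) := by
  have : sqrtTwoM m ≠ 0 := by
    rw [sqrtTwoM, Complex.ofReal_ne_zero]
    positivity
  rw [charge, mul_div_cancel₀ _ this]
  push_cast
  rfl

/-- The coefficient of `z^e` in the vertex operator. On the `k`-th summand it is the coefficient of
`z^e` in `exp(…) exp(…) z^(2mk+i)`, followed by the identification `|μ⟩ ↦ |μ + √(2m)⟩` of the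
`k`-th summand with the `(k+1)`-st one. -/
def vertexCoeff (m i : ℕ) (e : ℤ) : Module.End ℂ (LatticeModule m i) :=
  Finsupp.lsum ℂ fun k : ℤ =>
    (Finsupp.lsingle (k + 1)).comp (expProductCoeff m (charge m i k) (e - (2 * m * k + i)))

theorem vertexCoeff_bddBelow (m i : ℕ) (x : LatticeModule m i) :
    BddBelow (Function.support fun e => vertexCoeff m i e x) := by
  induction x using Finsupp.induction_linear with
  | zero => simp
  | add x y hx hy =>
    refine (hx.union hy).mono ?_
    simp only [map_add]
    exact Function.support_add _ _
  | single k p =>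
    obtain ⟨d, hd⟩ := exists_mem_degLE p
    refine ⟨(2 * m * k + i) - d, fun e he => ?_⟩
    by_contra hlt
    apply he
    simp only [vertexCoeff, Finsupp.lsum_single, LinearMap.comp_apply]
    have : expProductCoeff m (charge m i k) (e - (2 * m * k + i)) p = 0 := by
      change (∑ᶠ s : ℕ, _) = 0
      apply finsum_eq_zero_of_forall_eq_zero
      intro s
      by_cases hs : d < s
      · rw [annihilationCoeff_eq_zero m _ s d hs hd, map_zero]
      · rw [creationCoeff, if_neg (by omega), LinearMap.zero_apply]
    rw [this, map_zero]

/-- The bosonic vertex operator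
`φ(z) = e^{√(2m)} z^{√(2m) h₀} exp(√(2m) ∑_{n ≥ 1} (h₋ₙ / n) zⁿ) exp(-√(2m) ∑_{n ≥ 1} (hₙ / n) z⁻ⁿ)`
acting on `L_{(m),i}`. -/
def phi (m i : ℕ) : VertexOperator ℂ (LatticeModule m i) :=
  VertexOperator.of_coeff (vertexCoeff m i) (vertexCoeff_bddBelow m i)

/-- The modes `a_n` of `φ(z) = ∑ₙ a_n z^(-n-1)`. -/
def mode (m i : ℕ) (n : ℤ) : Module.End ℂ (LatticeModule m i) :=
  VertexOperator.ncoeff (phi m i) n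

/-- The extremal vector `v_p = |-p/√(2m)⟩` of `L_{(m),i}` for `p = -i + 2mn`: the highest weight
vector of the summand of weight `(2m(-n)+i)/√(2m)`. -/
def extremalVector (m i : ℕ) (n : ℤ) : LatticeModule m i := Finsupp.single (-n) 1

/-! ### Admissible sequences and semi-infinite monomials -/

/-- From the position `-i+2mn-1` on, `s` is the periodic sequence with `1` at the positions
`-i+2mk-1` and `0` elsewhere. -/
def PeriodicFrom (m i : ℕ) (s : ℤ → ℕ) (n : ℤ) : Prop :=
  (∀ k : ℤ, n ≤ k → s (-i + 2 * m * k - 1) = 1) ∧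
    ∀ j : ℤ, -i + 2 * m * n - 1 ≤ j → ¬ (2 * m : ℤ) ∣ j + i + 1 → s j = 0

/-- The sequences `(s_j)_{j ∈ ℤ}` of non-negative integers that label the basis of `L_{(m),i}`. -/
def IsAdmissible (m i : ℕ) (s : ℤ → ℕ) : Prop :=
  (∃ n : ℤ, PeriodicFrom m i s n) ∧
  (∃ N : ℤ, ∀ j < N, s j = 0) ∧
  ∀ j : ℤ, ∑ t ∈ Finset.range (2 * m), s (j + t) ≤ 1

/-- The product of the operators `a_j ^ s_j` over `N ≤ j < M`, from left to right in the order of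
increasing `j`. -/
def modeMonomial (m i : ℕ) (s : ℤ → ℕ) (N M : ℤ) : Module.End ℂ (LatticeModule m i) :=
  ((List.range (M - N).toNat).map fun t : ℕ => mode m i (N + t) ^ s (N + t)).prod

end LatticeVA

end

noncomputable section

namespace LatticeVA

/-! ### The Euler operator and exponentials of power series -/

section Exponential

variable {A : Type*} [Ring A]

/-! The charge only shifts the power of `z`, so on the summand of index `k` the mode `a_j` acts as
the coefficient of `z^t`, `t = -j - 1 - (2mk + i)`, of a single operator `H(z) E(z⁻¹)` on
polynomials. Here `H(z) = exp(√(2m) ∑ Xₙ zⁿ / n) = ∑ H_t z^t` acts by multiplication, and `E(w) =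
exp(-√(2m) ∑ wⁿ ∂/∂Xₙ)` is the exponential of derivations, hence multiplicative, with `E(w) H(z) =
(1 - wz)^(2m) H(z)` (`shiftCoeff_mul`, `shiftCoeff_completeHInt`). The coefficients of `(1 -
w)^(2m)` are palindromic because `2m` is even, and this symmetry makes the modes commute.

The monomials in `H₁, H₂, …` are a basis of the Fock space (`basisH`). Applying components of
degrees `t₁ ≥ t₂ ≥ …` to the vacuum gives `H_{t₁} H_{t₂} ⋯` plus products in which degree has moved
from later factors to earlier ones. Such moves strictly increase the sum of squares of the degrees,
so the vectors indexed by partitions are unitriangular over the `H`-monomials and form a basis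
(`fockVector_sub_basisH`, `exists_basis_of_unitriangular`).

An admissible sequence is its set of ones, with gaps at least `2m` and eventually periodic. The
displacements of the ones from a periodic ground state form a partition, and the ground state
records the charge. Under this bijection the monomial vector of a sequence is the vector of its
partition, whichever `n` is chosen (`exists_partition_modeMonomial`). -/

theorem commute_of_coeff {f g : PowerSeries A}
    (h : ∀ a b, Commute (PowerSeries.coeff a f) (PowerSeries.coeff b g)) : Commute f g := by
  ext n
  rw [PowerSeries.coeff_mul, PowerSeries.coeff_mul,
    ← Finset.Nat.sum_antidiagonal_swap]
  exact Finset.sum_congr rfl fun p _ => h _ _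

theorem coeff_pow_eq_zero {f : PowerSeries A} (h0 : PowerSeries.coeff 0 f = 0) (k : ℕ) :
    ∀ b < k, PowerSeries.coeff b (f ^ k) = 0 := by
  induction k with
  | zero => intro b hb; omega
  | succ k ih =>
    intro b hb
    rw [pow_succ', PowerSeries.coeff_mul]
    refine Finset.sum_eq_zero fun p hp => ?_
    rw [Finset.HasAntidiagonal.mem_antidiagonal] at hp
    rcases Nat.eq_zero_or_pos p.1 with h | h
    · rw [h, h0, zero_mul]
    · rw [ih p.2 (by omega), mul_zero]

variable [Algebra ℂ A]

/-- The operator on power series that acts on the coefficient of `zⁿ` by `d n`. -/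
def coeffwise (d : ℕ → A →ₗ[ℂ] A) (f : PowerSeries A) : PowerSeries A :=
  PowerSeries.mk fun n => d n (PowerSeries.coeff n f)

theorem coeff_coeffwise (d : ℕ → A →ₗ[ℂ] A) (f : PowerSeries A) (n : ℕ) :
    PowerSeries.coeff n (coeffwise d f) = d n (PowerSeries.coeff n f) :=
  PowerSeries.coeff_mk _ _

/-- The graded Leibniz rule covers both the Euler operator, `d n = n`, and a fixed derivation of the
coefficients, `d` constant. -/
theorem coeffwise_mul {d : ℕ → A →ₗ[ℂ] A}
    (h : ∀ a b x y, d (a + b) (x * y) = d a x * y + x * d b y) (f g : PowerSeries A) :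
    coeffwise d (f * g) = coeffwise d f * g + f * coeffwise d g := by
  ext n
  rw [coeff_coeffwise, map_add, PowerSeries.coeff_mul, PowerSeries.coeff_mul,
    PowerSeries.coeff_mul, map_sum, ← Finset.sum_add_distrib]
  refine Finset.sum_congr rfl fun p hp => ?_
  rw [Finset.HasAntidiagonal.mem_antidiagonal] at hp
  rw [coeff_coeffwise, coeff_coeffwise, ← h, hp]

theorem coeffwise_pow {d : ℕ → A →ₗ[ℂ] A}
    (hd : ∀ a b x y, d (a + b) (x * y) = d a x * y + x * d b y) {f : PowerSeries A}
    (h : Commute f (coeffwise d f)) (k : ℕ) :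
    coeffwise d (f ^ (k + 1)) = (k + 1) • (coeffwise d f * f ^ k) := by
  induction k with
  | zero => simp
  | succ k ih =>
    rw [pow_succ' f (k + 1), coeffwise_mul hd, ih, mul_smul_comm, ← mul_assoc, h.eq, mul_assoc,
      ← pow_succ', add_smul (k + 1) 1, one_smul, add_comm]

theorem coeff_expSeries {f : PowerSeries A} (h0 : PowerSeries.coeff 0 f = 0) {n K : ℕ}
    (hK : n < K) : PowerSeries.coeff n (expSeries f) =
      ∑ k ∈ Finset.range K, ((k.factorial : ℂ)⁻¹) • PowerSeries.coeff n (f ^ k) := by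
  rw [expSeries, PowerSeries.coeff_mk]
  refine Finset.sum_subset (Finset.range_mono hK) fun k _ hk => ?_
  rw [coeff_pow_eq_zero h0 k n (by simpa using hk), smul_zero]

theorem coeff_zero_expSeries (f : PowerSeries A) :
    PowerSeries.coeff 0 (expSeries f) = 1 := by
  simp [expSeries]

theorem coeffwise_expSeries {d : ℕ → A →ₗ[ℂ] A}
    (hd : ∀ a b x y, d (a + b) (x * y) = d a x * y + x * d b y) {f : PowerSeries A}
    (h0 : PowerSeries.coeff 0 f = 0) (h : Commute f (coeffwise d f)) :
    coeffwise d (expSeries f) = coeffwise d f * expSeries f := by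
  ext n
  rw [coeff_coeffwise, coeff_expSeries h0 (K := n + 1 + 1) (by omega), Finset.sum_range_succ',
    PowerSeries.coeff_mul, map_add, map_sum]
  -- The Leibniz rule for `1 * 1 = 1` forces the derivation to kill `1`.
  have e0 : d n ((((Nat.factorial 0 : ℕ) : ℂ)⁻¹) • PowerSeries.coeff n (f ^ 0)) = 0 := by
    have := coeffwise_mul hd (1 : PowerSeries A) 1
    rw [mul_one, mul_one, one_mul, right_eq_add] at this
    rw [map_smul, pow_zero, ← coeff_coeffwise, this, map_zero, smul_zero]
  rw [e0, add_zero]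
  have e1 : ∀ p ∈ Finset.HasAntidiagonal.antidiagonal n,
      PowerSeries.coeff p.1 (coeffwise d f) * PowerSeries.coeff p.2 (expSeries f) =
        ∑ k ∈ Finset.range (n + 1), ((k.factorial : ℂ)⁻¹) •
          (PowerSeries.coeff p.1 (coeffwise d f) * PowerSeries.coeff p.2 (f ^ k)) := by
    intro p hp
    rw [Finset.HasAntidiagonal.mem_antidiagonal] at hp
    rw [coeff_expSeries h0 (K := n + 1) (by omega), Finset.mul_sum]
    exact Finset.sum_congr rfl fun k _ => mul_smul_comm _ _ _
  rw [Finset.sum_congr rfl e1, Finset.sum_comm]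
  refine Finset.sum_congr rfl fun k _ => ?_
  rw [← Finset.smul_sum, ← PowerSeries.coeff_mul, map_smul, ← coeff_coeffwise,
    coeffwise_pow hd h, map_nsmul, ← Nat.cast_smul_eq_nsmul ℂ, smul_smul, Nat.factorial_succ]
  congr 1
  push_cast
  have : (k : ℂ) + 1 ≠ 0 := by exact_mod_cast Nat.succ_ne_zero k
  have : (k.factorial : ℂ) ≠ 0 := by exact_mod_cast k.factorial_ne_zero
  field_simp

/-- The recursion for the coefficients of `exp f` that comes from `z d/dz`. -/
theorem coeff_expSeries_rec {f : PowerSeries A} (h0 : PowerSeries.coeff 0 f = 0)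
    (h : ∀ a b, Commute (PowerSeries.coeff a f) (PowerSeries.coeff b f)) (n : ℕ) :
    (n : ℂ) • PowerSeries.coeff n (expSeries f) =
      ∑ p ∈ Finset.HasAntidiagonal.antidiagonal n,
        (p.1 : ℂ) • (PowerSeries.coeff p.1 f * PowerSeries.coeff p.2 (expSeries f)) := by
  have := congrArg (PowerSeries.coeff n) (coeffwise_expSeries
    (d := fun n => (n : ℂ) • LinearMap.id) (by intros; simp [add_smul]) h0
    (commute_of_coeff fun a b => by
      rw [coeff_coeffwise]
      exact (h a b).smul_right (b : ℂ)))
  rw [coeff_coeffwise, PowerSeries.coeff_mul] at this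
  simpa only [coeff_coeffwise, LinearMap.smul_apply, LinearMap.id_apply, smul_mul_assoc] using this

theorem commute_coeff_expSeries {f : PowerSeries A} {x : A}
    (h : ∀ n, Commute x (PowerSeries.coeff n f)) (n : ℕ) :
    Commute x (PowerSeries.coeff n (expSeries f)) := by
  have key : ∀ k n, Commute x (PowerSeries.coeff n (f ^ k)) := by
    intro k
    induction k with
    | zero =>
      intro n
      rw [pow_zero, PowerSeries.coeff_one]
      split_ifs
      · exact Commute.one_right _
      · exact Commute.zero_right _
    | succ k ih =>
      intro n
      rw [pow_succ', PowerSeries.coeff_mul]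
      exact Commute.sum_right _ _ _ fun p _ => (h _).mul_right (ih _)
  rw [expSeries, PowerSeries.coeff_mk]
  exact Commute.sum_right _ _ _ fun k _ => (key k n).smul_right _

theorem map_expSeries {B : Type*} [Ring B] [Algebra ℂ B] (g : A →ₐ[ℂ] B) (f : PowerSeries A)
    (n : ℕ) : PowerSeries.coeff n (expSeries (PowerSeries.map g.toRingHom f)) =
      g (PowerSeries.coeff n (expSeries f)) := by
  simp only [expSeries, PowerSeries.coeff_mk, map_sum, map_smul, ← map_pow,
    PowerSeries.coeff_map]
  rfl

end Exponential

/-! ### The creation part -/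

theorem sqrtTwoM_mul_self (m : ℕ) : sqrtTwoM m * sqrtTwoM m = 2 * m := by
  rw [sqrtTwoM, ← Complex.ofReal_mul, Real.mul_self_sqrt (by positivity)]
  push_cast
  rfl

theorem sqrtTwoM_ne_zero {m : ℕ} (hm : 0 < m) : sqrtTwoM m ≠ 0 := by
  rw [sqrtTwoM, Complex.ofReal_ne_zero]
  positivity

/-- The power series `√(2m) ∑ Xₙ zⁿ / n`. -/
def powerSumSeries (m : ℕ) : PowerSeries FockSpace :=
  PowerSeries.mk fun n => if h : 0 < n then (sqrtTwoM m / n) • MvPolynomial.X (n.toPNat h) else 0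

/-- The coefficients `H₀, H₁, …` of `exp(√(2m) ∑ Xₙ zⁿ / n)`. -/
def completeH (m n : ℕ) : FockSpace := PowerSeries.coeff n (expSeries (powerSumSeries m))

/-- The coefficients `H_t` of `exp(√(2m) ∑ Xₙ zⁿ / n)` for all integers `t`. -/
def completeHInt (m : ℕ) (t : ℤ) : FockSpace := if 0 ≤ t then completeH m t.toNat else 0

theorem completeHInt_natCast (m n : ℕ) : completeHInt m n = completeH m n := by
  simp [completeHInt]

theorem completeHInt_neg {m : ℕ} {t : ℤ} (h : t < 0) : completeHInt m t = 0 := by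
  rw [completeHInt, if_neg (by omega)]

theorem completeH_zero (m : ℕ) : completeH m 0 = 1 := coeff_zero_expSeries _

/-- All creation operators are multiplications, so their exponential can be computed in the
commutative polynomial ring. -/
theorem creationExponent_eq (m : ℕ) (μ : ℂ) : creationExponent m μ =
    PowerSeries.map (Algebra.lmul ℂ FockSpace).toRingHom (powerSumSeries m) := by
  ext n : 1
  rw [creationExponent, PowerSeries.coeff_mk, PowerSeries.coeff_map, powerSumSeries,
    PowerSeries.coeff_mk]
  rcases n with _ | n
  · simp
  · rw [if_neg (Nat.succ_ne_zero n), dif_pos n.succ_pos]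
    refine Eq.trans ?_ (map_smul (Algebra.lmul ℂ FockSpace) _ _).symm
    rfl

theorem creationCoeff_apply (m : ℕ) (μ : ℂ) (t : ℤ) (p : FockSpace) :
    creationCoeff m μ t p = completeHInt m t * p := by
  rw [creationCoeff, completeHInt]
  split_ifs
  · rw [creationExponent_eq, map_expSeries]
    rfl
  · simp

theorem completeH_rec (m n : ℕ) : (n : ℂ) • completeH m n =
    ∑ p ∈ Finset.HasAntidiagonal.antidiagonal n,
      (p.1 : ℂ) • (PowerSeries.coeff p.1 (powerSumSeries m) * completeH m p.2) :=
  coeff_expSeries_rec (by simp [powerSumSeries]) (fun _ _ => Commute.all _ _) n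

/-! ### The annihilation part -/

/-- The derivation `-√(2m) ∂/∂Xₙ`. -/
def shiftDer (m : ℕ) (n : ℕ) : Derivation ℂ FockSpace FockSpace :=
  if h : 0 < n then (-sqrtTwoM m) • MvPolynomial.pderiv (n.toPNat h) else 0

/-- The coefficients of `exp(-√(2m) ∑ wⁿ ∂/∂Xₙ)`. -/
def shiftCoeff (m s : ℕ) : Module.End ℂ FockSpace :=
  PowerSeries.coeff s (expSeries (PowerSeries.mk fun n => (shiftDer m n).toLinearMap))

/-- The factor `n` in `hₙ = n ∂/∂Xₙ` cancels the denominator, and `h₀`, the only mode depending on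
`μ`, does not occur. -/
theorem annihilationCoeff_eq (m : ℕ) (μ : ℂ) (s : ℕ) :
    annihilationCoeff m μ s = shiftCoeff m s := by
  rw [annihilationCoeff, shiftCoeff]
  congr 2
  ext n : 1
  rw [annihilationExponent, PowerSeries.coeff_mk, PowerSeries.coeff_mk]
  rcases n with _ | n
  · simp [shiftDer]
  · rw [if_neg (Nat.succ_ne_zero n), shiftDer, dif_pos n.succ_pos]
    have : heisenberg μ ((n + 1 : ℕ) : ℤ) =
      ((n + 1 : ℕ) : ℂ) • (MvPolynomial.pderiv n.succPNat).toLinearMap := rfl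
    rw [this, smul_smul, neg_mul, div_mul_cancel₀ _ (by exact_mod_cast Nat.succ_ne_zero n)]
    rfl

theorem shiftCoeff_zero (m : ℕ) : shiftCoeff m 0 = 1 := coeff_zero_expSeries _

/-- The commutator is a derivation that vanishes on the variables. -/
theorem pderiv_comm (i j : ℕ+) (p : FockSpace) :
    MvPolynomial.pderiv i (MvPolynomial.pderiv j p) =
      MvPolynomial.pderiv j (MvPolynomial.pderiv i p) := by
  have : ⁅MvPolynomial.pderiv (R := ℂ) i, MvPolynomial.pderiv (R := ℂ) j⁆ = 0 := by
    apply MvPolynomial.derivation_ext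
    intro k
    rw [Derivation.commutator_apply]
    simp [MvPolynomial.pderiv_X, Pi.single_apply, apply_ite]
  have h := congrArg (fun D => D p) this
  simp only [Derivation.commutator_apply] at h
  exact sub_eq_zero.1 h

theorem shiftDer_comm (m a b : ℕ) :
    Commute (shiftDer m a).toLinearMap (shiftDer m b).toLinearMap := by
  refine LinearMap.ext fun p => ?_
  change shiftDer m a (shiftDer m b p) = shiftDer m b (shiftDer m a p)
  rw [shiftDer, shiftDer]
  split_ifs
  · simp only [Derivation.smul_apply, Derivation.map_smul, pderiv_comm (a.toPNat _) (b.toPNat _)]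
  all_goals simp

theorem shiftCoeff_commute_shiftDer (m s a : ℕ) :
    Commute (shiftDer m a).toLinearMap (shiftCoeff m s) :=
  commute_coeff_expSeries (fun n => by rw [PowerSeries.coeff_mk]; exact shiftDer_comm m a n) s

theorem shiftCoeff_commute (m s t : ℕ) : Commute (shiftCoeff m s) (shiftCoeff m t) :=
  commute_coeff_expSeries
    (fun n => by rw [PowerSeries.coeff_mk]; exact (shiftCoeff_commute_shiftDer m s n).symm) t

theorem shiftCoeff_rec (m s : ℕ) (p : FockSpace) : (s : ℂ) • shiftCoeff m s p =
    ∑ x ∈ Finset.HasAntidiagonal.antidiagonal s, (x.1 : ℂ) • shiftDer m x.1 (shiftCoeff m x.2 p) := by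
  have := congrArg (fun L : Module.End ℂ FockSpace => L p) (coeff_expSeries_rec
    (f := PowerSeries.mk fun n => (shiftDer m n).toLinearMap) (by simp [shiftDer])
    (fun a b => by
      rw [PowerSeries.coeff_mk, PowerSeries.coeff_mk]
      exact shiftDer_comm m a b) s)
  simp only [LinearMap.smul_apply, LinearMap.sum_apply, Module.End.mul_apply,
    PowerSeries.coeff_mk] at this
  exact this

theorem shiftCoeff_rec' (m s : ℕ) (p : FockSpace) : (s : ℂ) • shiftCoeff m s p =
    ∑ x ∈ Finset.HasAntidiagonal.antidiagonal s, (x.1 : ℂ) • shiftCoeff m x.2 (shiftDer m x.1 p) := by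
  rw [shiftCoeff_rec]
  refine Finset.sum_congr rfl fun x _ => ?_
  congr 1
  exact congrArg (fun L : Module.End ℂ FockSpace => L p)
    (shiftCoeff_commute_shiftDer m x.2 x.1).eq

theorem sum_antidiagonal_assoc {M : Type*} [AddCommMonoid M] (F : ℕ → ℕ → ℕ → M) (n : ℕ) :
    ∑ x ∈ Finset.HasAntidiagonal.antidiagonal n,
      ∑ y ∈ Finset.HasAntidiagonal.antidiagonal x.2, F x.1 y.1 y.2 =
    ∑ x ∈ Finset.HasAntidiagonal.antidiagonal n,
      ∑ y ∈ Finset.HasAntidiagonal.antidiagonal x.1, F y.1 y.2 x.2 := by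
  simp only [Finset.sum_sigma']
  refine Finset.sum_nbij' (fun x => ⟨(x.1.1 + x.2.1, x.2.2), (x.1.1, x.2.1)⟩)
    (fun x => ⟨(x.2.1, x.2.2 + x.1.2), (x.2.2, x.1.2)⟩) ?_ ?_ ?_ ?_ ?_
  · rintro ⟨⟨a, b⟩, ⟨c, d⟩⟩ h
    simp only [Finset.mem_sigma, Finset.HasAntidiagonal.mem_antidiagonal] at h ⊢
    obtain ⟨rfl, rfl⟩ := h
    simp [add_assoc]
  · rintro ⟨⟨a, b⟩, ⟨c, d⟩⟩ h
    simp only [Finset.mem_sigma, Finset.HasAntidiagonal.mem_antidiagonal] at h ⊢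
    obtain ⟨rfl, rfl⟩ := h
    simp [add_assoc]
  · rintro ⟨⟨a, b⟩, ⟨c, d⟩⟩ h
    simp only [Finset.mem_sigma, Finset.HasAntidiagonal.mem_antidiagonal] at h
    obtain ⟨rfl, rfl⟩ := h
    rfl
  · rintro ⟨⟨a, b⟩, ⟨c, d⟩⟩ h
    simp only [Finset.mem_sigma, Finset.HasAntidiagonal.mem_antidiagonal] at h
    obtain ⟨rfl, rfl⟩ := h
    rfl
  · rintro ⟨⟨a, b⟩, ⟨c, d⟩⟩ _
    rfl

theorem sum_antidiagonal_left_comm {M : Type*} [AddCommMonoid M] (F : ℕ → ℕ → ℕ → M) (n : ℕ) :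
    ∑ x ∈ Finset.HasAntidiagonal.antidiagonal n,
      ∑ y ∈ Finset.HasAntidiagonal.antidiagonal x.2, F x.1 y.1 y.2 =
    ∑ x ∈ Finset.HasAntidiagonal.antidiagonal n,
      ∑ y ∈ Finset.HasAntidiagonal.antidiagonal x.2, F y.1 x.1 y.2 := by
  rw [sum_antidiagonal_assoc, sum_antidiagonal_assoc fun a b c => F b a c]
  refine Finset.sum_congr rfl fun x _ => ?_
  exact (Finset.Nat.sum_antidiagonal_swap (f := fun y => F y.1 y.2 x.2)).symm

/-- The exponential of a derivation is multiplicative: by the Leibniz rule both sides satisfy the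
recursion coming from `w d/dw`, so strong induction on `s` applies. -/
theorem shiftCoeff_mul (m s : ℕ) (p q : FockSpace) : shiftCoeff m s (p * q) =
    ∑ x ∈ Finset.HasAntidiagonal.antidiagonal s,
      shiftCoeff m x.1 p * shiftCoeff m x.2 q := by
  induction s using Nat.strong_induction_on with
  | _ s ih =>
    rcases Nat.eq_zero_or_pos s with rfl | hs
    · simp [shiftCoeff_zero]
    have hs0 : (s : ℂ) ≠ 0 := by exact_mod_cast hs.ne'
    refine smul_right_injective FockSpace hs0 ?_
    simp only
    rw [shiftCoeff_rec]
    have e1 : ∀ x ∈ Finset.HasAntidiagonal.antidiagonal s,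
        (x.1 : ℂ) • shiftDer m x.1 (shiftCoeff m x.2 (p * q)) =
        ∑ y ∈ Finset.HasAntidiagonal.antidiagonal x.2,
            ((x.1 : ℂ) • shiftDer m x.1 (shiftCoeff m y.1 p)) * shiftCoeff m y.2 q +
        ∑ y ∈ Finset.HasAntidiagonal.antidiagonal x.2,
            shiftCoeff m y.1 p * ((x.1 : ℂ) • shiftDer m x.1 (shiftCoeff m y.2 q)) := by
      intro x hx
      rw [Finset.HasAntidiagonal.mem_antidiagonal] at hx
      rcases Nat.eq_zero_or_pos x.1 with h | h
      · simp [h]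
      · rw [ih x.2 (by omega), map_sum, Finset.smul_sum, ← Finset.sum_add_distrib]
        refine Finset.sum_congr rfl fun y _ => ?_
        rw [Derivation.leibniz, smul_eq_mul, smul_eq_mul, smul_add, mul_smul_comm, smul_mul_assoc,
          add_comm, mul_comm (shiftCoeff m y.2 q)]
    rw [Finset.sum_congr rfl e1, Finset.sum_add_distrib,
      sum_antidiagonal_assoc fun a b c =>
        ((a : ℂ) • shiftDer m a (shiftCoeff m b p)) * shiftCoeff m c q,
      sum_antidiagonal_left_comm fun a b c =>
        shiftCoeff m b p * ((a : ℂ) • shiftDer m a (shiftCoeff m c q)),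
      ← Finset.sum_add_distrib, Finset.smul_sum]
    refine Finset.sum_congr rfl fun x hx => ?_
    rw [Finset.HasAntidiagonal.mem_antidiagonal] at hx
    rw [← Finset.sum_mul, ← Finset.mul_sum, ← shiftCoeff_rec, ← shiftCoeff_rec, ← hx,
      smul_mul_assoc, mul_smul_comm, ← add_smul]
    push_cast
    rfl

/-- The derivation sends the exponent `√(2m) ∑ Xₙ zⁿ / n` to `-(2m / a) z^a`, so it multiplies the
exponential by this monomial. -/
theorem smul_shiftDer_completeHInt {m a : ℕ} (ha : 0 < a) (t : ℤ) :
    (a : ℂ) • shiftDer m a (completeHInt m t) = (-(2 * m : ℂ)) • completeHInt m (t - a) := by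
  rcases lt_or_ge t 0 with ht | ht
  · rw [completeHInt_neg ht, completeHInt_neg (by omega), map_zero, smul_zero, smul_zero]
  lift t to ℕ using ht
  rw [completeHInt_natCast]
  have h := congrArg (PowerSeries.coeff t) (coeffwise_expSeries (f := powerSumSeries m)
    (d := fun _ => (shiftDer m a).toLinearMap)
    (fun _ _ x y => by
      change shiftDer m a (x * y) = shiftDer m a x * y + x * shiftDer m a y
      rw [Derivation.leibniz, smul_eq_mul, smul_eq_mul, add_comm, mul_comm y])
    (by simp [powerSumSeries]) (Commute.all _ _))
  rw [coeff_coeffwise, PowerSeries.coeff_mul] at h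
  have hf : ∀ x, PowerSeries.coeff x (coeffwise (fun _ => (shiftDer m a).toLinearMap)
      (powerSumSeries m)) = if x = a then MvPolynomial.C (-(2 * m : ℂ) / a) else 0 := by
    intro x
    rw [coeff_coeffwise, powerSumSeries, PowerSeries.coeff_mk]
    change shiftDer m a _ = _
    rw [shiftDer, dif_pos ha]
    split_ifs with h1 h2 h2
    · subst h2
      rw [Derivation.smul_apply, Derivation.map_smul, MvPolynomial.pderiv_X_self, smul_smul,
        MvPolynomial.C_eq_smul_one, ← sqrtTwoM_mul_self]
      congr 1
      ring
    · rw [Derivation.smul_apply, Derivation.map_smul, MvPolynomial.pderiv_X_of_ne, smul_zero,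
        smul_zero]
      intro e
      exact h2 (congrArg PNat.val e)
    · omega
    · simp
  simp only [hf] at h
  change shiftDer m a (completeH m t) = _ at h
  rw [h]
  rcases lt_or_ge t a with hta | hta
  · rw [completeHInt_neg (by omega), smul_zero, Finset.sum_eq_zero, smul_zero]
    intro x hx
    rw [Finset.HasAntidiagonal.mem_antidiagonal] at hx
    rw [if_neg (by omega), zero_mul]
  · rw [Finset.sum_eq_single (a, t - a)]
    · rw [if_pos rfl, MvPolynomial.C_mul', smul_smul, mul_div_cancel₀ _ (by exact_mod_cast ha.ne')]
      have : (t : ℤ) - a = ((t - a : ℕ) : ℤ) := by omega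
      rw [this, completeHInt_natCast]
      rfl
    · rintro ⟨x, y⟩ hx hne
      rw [Finset.HasAntidiagonal.mem_antidiagonal] at hx
      simp only at hx ⊢
      rw [if_neg, zero_mul]
      rintro rfl
      exact hne (by rw [Prod.mk.injEq]; omega)
    · intro hn
      exact absurd (Finset.HasAntidiagonal.mem_antidiagonal.2 (by simp only; omega)) hn

/-- This is `w d/dw (1 - w)^M = -M · w / (1 - w) · (1 - w)^M`, read off at `w^s`. -/
theorem alternating_choose_rec (M s : ℕ) (hs : 0 < s) :
    (s : ℂ) * ((-1) ^ s * (M.choose s : ℂ)) =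
      ∑ x ∈ Finset.range s, -(M : ℂ) * ((-1) ^ x * (M.choose x : ℂ)) := by
  obtain ⟨s, rfl⟩ := Nat.exists_eq_add_of_lt hs
  rw [zero_add, ← Finset.mul_sum]
  rcases M with _ | M
  · simp
  have h := congrArg (Int.cast : ℤ → ℂ)
    (Int.alternating_sum_range_choose_eq_choose (n := M) (m := s))
  push_cast at h
  rw [h]
  have h2 : ((M + 1 : ℕ) : ℂ) * (M.choose s : ℂ) = ((M + 1).choose (s + 1) : ℂ) * ((s + 1 : ℕ) : ℂ) := by
    exact_mod_cast Nat.add_one_mul_choose_eq M s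
  rw [mul_comm, mul_assoc, ← h2, pow_succ]
  ring

/-- Shifting each `Xₙ` by `-√(2m) wⁿ` adds `-2m ∑ (wz)ⁿ / n = 2m log(1 - wz)` to the exponent of
`H(z)`. The proof compares recursions in `s`. -/
theorem shiftCoeff_completeHInt (m s : ℕ) (t : ℤ) : shiftCoeff m s (completeHInt m t) =
    ((-1 : ℂ) ^ s * ((2 * m).choose s : ℂ)) • completeHInt m (t - s) := by
  induction s using Nat.strong_induction_on generalizing t with
  | _ s ih =>
    rcases Nat.eq_zero_or_pos s with rfl | hs
    · simp [shiftCoeff_zero]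
    have hs0 : (s : ℂ) ≠ 0 := by exact_mod_cast hs.ne'
    refine smul_right_injective FockSpace hs0 ?_
    simp only
    -- After the swap `x` is the order of the remaining shift and `s - x` the index of the
    -- derivation; the term `x = s` has weight zero.
    rw [shiftCoeff_rec', smul_smul, alternating_choose_rec _ _ hs, Finset.sum_smul,
      ← Finset.Nat.sum_antidiagonal_swap, Finset.Nat.sum_antidiagonal_eq_sum_range_succ_mk,
      Finset.sum_range_succ]
    simp only [Prod.swap, Nat.sub_self, Nat.cast_zero, zero_smul, add_zero]
    refine Finset.sum_congr rfl fun x hx => ?_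
    rw [Finset.mem_range] at hx
    rw [← map_smul, smul_shiftDer_completeHInt (by omega), map_smul, ih x hx, smul_smul]
    push_cast [hx.le]
    congr 2
    ring

/-! ### The components of the vertex operator -/

/-- The coefficient of `z^t` in the exponential part of the vertex operator. -/
def vertexOp (m : ℕ) (t : ℤ) : Module.End ℂ FockSpace := expProductCoeff m 0 t

theorem exists_shiftCoeff_eq_zero (m : ℕ) (p : FockSpace) :
    ∃ D, ∀ s ≥ D, shiftCoeff m s p = 0 := by
  obtain ⟨d, hd⟩ := exists_mem_degLE p
  refine ⟨d + 1, fun s hs => ?_⟩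
  rw [← annihilationCoeff_eq m 0]
  exact annihilationCoeff_eq_zero m 0 s d (by omega) hd

theorem expProductCoeff_apply (m : ℕ) (μ : ℂ) (t : ℤ) (p : FockSpace) {D : ℕ}
    (hD : ∀ s ≥ D, shiftCoeff m s p = 0) : expProductCoeff m μ t p =
      ∑ s ∈ Finset.range D, completeHInt m (t + s) * shiftCoeff m s p := by
  change (∑ᶠ s : ℕ, creationCoeff m μ (t + s) (annihilationCoeff m μ s p)) = _
  simp only [creationCoeff_apply, annihilationCoeff_eq]
  refine finsum_eq_sum_of_support_subset _ fun s hs => ?_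
  by_contra h
  apply hs
  simp only [hD s (by simpa using h), mul_zero]

theorem vertexOp_apply (m : ℕ) (t : ℤ) (p : FockSpace) {D : ℕ}
    (hD : ∀ s ≥ D, shiftCoeff m s p = 0) : vertexOp m t p =
      ∑ s ∈ Finset.range D, completeHInt m (t + s) * shiftCoeff m s p :=
  expProductCoeff_apply m 0 t p hD

theorem expProductCoeff_eq (m : ℕ) (μ : ℂ) (t : ℤ) : expProductCoeff m μ t = vertexOp m t := by
  refine LinearMap.ext fun p => ?_
  obtain ⟨D, hD⟩ := exists_shiftCoeff_eq_zero m p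
  rw [expProductCoeff_apply m μ t p hD, vertexOp_apply m t p hD]

theorem mode_single (m i : ℕ) (j k : ℤ) (p : FockSpace) :
    mode m i j (Finsupp.single k p) =
      Finsupp.single (k + 1) (vertexOp m (-j - 1 - (2 * m * k + i)) p) := by
  rw [mode, phi, VertexOperator.ncoeff_of_coeff, vertexCoeff, Finsupp.lsum_single,
    LinearMap.comp_apply, expProductCoeff_eq]
  rfl

/-- The coefficients of `(1 - w)^(2m)`. -/
def altChoose (m x : ℕ) : ℂ := (-1) ^ x * ((2 * m).choose x : ℂ)

theorem altChoose_symm (m x : ℕ) (hx : x ≤ 2 * m) :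
    altChoose m (2 * m - x) = altChoose m x := by
  rw [altChoose, altChoose, Nat.choose_symm hx]
  congr 1
  have : (-1 : ℂ) ^ (2 * m - x) * (-1) ^ x = 1 := by
    rw [← pow_add, Nat.sub_add_cancel hx, pow_mul]
    simp
  calc (-1 : ℂ) ^ (2 * m - x) = (-1) ^ (2 * m - x) * ((-1) ^ x * (-1) ^ x) := by
        rw [← mul_pow]; simp
    _ = (-1) ^ x := by rw [← mul_assoc, this, one_mul]

/-! ### Normal ordering and commutation of the modes -/

theorem shiftCoeff_completeHInt_mul (m s : ℕ) (r : ℤ) (q : FockSpace) :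
    shiftCoeff m s (completeHInt m r * q) = ∑ x ∈ Finset.HasAntidiagonal.antidiagonal s,
      altChoose m x.1 • (completeHInt m (r - x.1) * shiftCoeff m x.2 q) := by
  rw [shiftCoeff_mul]
  refine Finset.sum_congr rfl fun x _ => ?_
  rw [shiftCoeff_completeHInt, smul_mul_assoc, altChoose]

/-- Moving the vertex operator past `H_r` costs a factor `(1 - w)^(2m)`: each term takes `x` from
the degree `r` and gives it to the operator. -/
theorem vertexOp_completeHInt_mul (m : ℕ) (t r : ℤ) (q : FockSpace) :
    vertexOp m t (completeHInt m r * q) = ∑ x ∈ Finset.range (2 * m + 1),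
      altChoose m x • (completeHInt m (r - x) * vertexOp m (t + x) q) := by
  obtain ⟨D, hD⟩ := exists_shiftCoeff_eq_zero m q
  have hvan : ∀ a b : ℕ, ¬ (a < 2 * m + 1 ∧ b < D) →
      altChoose m a • (completeHInt m (r - a) * shiftCoeff m b q) = 0 := by
    intro a b hab
    by_cases ha : a < 2 * m + 1
    · rw [hD b (by omega), mul_zero, smul_zero]
    · rw [altChoose, Nat.choose_eq_zero_of_lt (by omega), Nat.cast_zero, mul_zero, zero_smul]
  have hE : ∀ s ≥ 2 * m + 1 + D, shiftCoeff m s (completeHInt m r * q) = 0 := by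
    intro s hs
    rw [shiftCoeff_completeHInt_mul]
    refine Finset.sum_eq_zero fun x hx => hvan _ _ ?_
    rw [Finset.HasAntidiagonal.mem_antidiagonal] at hx
    omega
  rw [vertexOp_apply m t _ hE]
  have hR : ∀ x ∈ Finset.range (2 * m + 1),
      altChoose m x • (completeHInt m (r - x) * vertexOp m (t + x) q) =
      ∑ y ∈ Finset.range D, completeHInt m (t + (x + y : ℕ)) *
        altChoose m x • (completeHInt m (r - x) * shiftCoeff m y q) := by
    intro x _
    rw [vertexOp_apply m _ q hD, Finset.mul_sum, Finset.smul_sum]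
    refine Finset.sum_congr rfl fun y _ => ?_
    rw [mul_smul_comm, mul_left_comm]
    push_cast
    rw [add_assoc]
  -- The pairs `(x, y)` are grouped by the total shift `s = x + y`; pairs outside the rectangle
  -- contribute zero by `hvan`.
  rw [Finset.sum_congr rfl hR, ← Finset.sum_product', ← Finset.sum_fiberwise_of_maps_to
    (s := Finset.range (2 * m + 1) ×ˢ Finset.range D) (t := Finset.range (2 * m + 1 + D))
    (g := fun x => x.1 + x.2)]
  · refine Finset.sum_congr rfl fun s _ => ?_
    rw [shiftCoeff_completeHInt_mul, Finset.mul_sum]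
    symm
    refine Eq.trans ?_ (Finset.sum_subset (s₁ := Finset.filter (fun x => x.1 + x.2 = s)
      (Finset.range (2 * m + 1) ×ˢ Finset.range D)) ?_ ?_)
    · refine Finset.sum_congr rfl fun x hx => ?_
      rw [(Finset.mem_filter.1 hx).2]
    · intro x hx
      exact Finset.HasAntidiagonal.mem_antidiagonal.2 (Finset.mem_filter.1 hx).2
    · intro x hx hx'
      rw [hvan, mul_zero]
      intro hlt
      apply hx'
      rw [Finset.mem_filter, Finset.mem_product, Finset.mem_range, Finset.mem_range]
      exact ⟨hlt, Finset.HasAntidiagonal.mem_antidiagonal.1 hx⟩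
  · intro x hx
    simp only [Finset.mem_product, Finset.mem_range] at hx ⊢
    omega

theorem shiftCoeff_comm_apply (m a b : ℕ) (p : FockSpace) :
    shiftCoeff m a (shiftCoeff m b p) = shiftCoeff m b (shiftCoeff m a p) :=
  congrArg (fun L : Module.End ℂ FockSpace => L p) (shiftCoeff_commute m a b).eq

theorem vertexOp_vertexOp (m : ℕ) (t₁ t₂ : ℤ) (p : FockSpace) {D : ℕ}
    (hD : ∀ s ≥ D, shiftCoeff m s p = 0) :
    vertexOp m (t₁ - 2 * m) (vertexOp m t₂ p) =
      ∑ u ∈ Finset.range D, ∑ y ∈ Finset.range D, ∑ x ∈ Finset.range (2 * m + 1),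
        altChoose m x • (completeHInt m (t₂ + u - x) * (completeHInt m (t₁ - 2 * m + x + y) *
          shiftCoeff m y (shiftCoeff m u p))) := by
  rw [vertexOp_apply m t₂ p hD, map_sum]
  refine Finset.sum_congr rfl fun u _ => ?_
  have hu : ∀ s ≥ D, shiftCoeff m s (shiftCoeff m u p) = 0 := fun s hs => by
    rw [shiftCoeff_comm_apply, hD s hs, map_zero]
  rw [vertexOp_completeHInt_mul, Finset.sum_comm]
  refine Finset.sum_congr rfl fun x _ => ?_
  rw [vertexOp_apply m _ _ hu, Finset.mul_sum, Finset.smul_sum]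

/-- In the normally ordered triple sum, exchanging `u` with `y` and reflecting `x` to `2m - x`
exchanges `t₁` with `t₂`; `altChoose_symm` makes this a symmetry without a sign. -/
theorem vertexOp_vertexOp_comm (m : ℕ) (t₁ t₂ : ℤ) (p : FockSpace) :
    vertexOp m (t₁ - 2 * m) (vertexOp m t₂ p) = vertexOp m (t₂ - 2 * m) (vertexOp m t₁ p) := by
  obtain ⟨D, hD⟩ := exists_shiftCoeff_eq_zero m p
  rw [vertexOp_vertexOp m t₁ t₂ p hD, vertexOp_vertexOp m t₂ t₁ p hD, Finset.sum_comm]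
  refine Finset.sum_congr rfl fun y _ => Finset.sum_congr rfl fun u _ => ?_
  rw [← Finset.sum_range_reflect]
  refine Finset.sum_congr rfl fun x hx => ?_
  rw [Finset.mem_range] at hx
  have e : 2 * m + 1 - 1 - x = 2 * m - x := by omega
  rw [e, altChoose_symm m x (by omega), mul_left_comm, shiftCoeff_comm_apply m y u]
  have e1 : t₁ - 2 * m + (2 * m - x : ℕ) + y = t₁ + y - x := by omega
  have e2 : t₂ + u - (2 * m - x : ℕ) = t₂ - 2 * m + x + u := by omega
  rw [e1, e2]

theorem mode_commute (m i : ℕ) (j k : ℤ) : Commute (mode m i j) (mode m i k) := by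
  refine Finsupp.lhom_ext fun l p => ?_
  rw [Module.End.mul_apply, Module.End.mul_apply, mode_single, mode_single, mode_single,
    mode_single]
  -- The mode that acts second meets the next summand, which lowers its degree by `2m`.
  have e : ∀ j : ℤ, -j - 1 - (2 * m * (l + 1) + i) = (-j - 1 - (2 * m * l + i)) - 2 * m :=
    fun j => by ring
  rw [e, e, vertexOp_vertexOp_comm]

/-! ### The generators `Hₙ` of the Fock space -/

/-- The variable `Xₙ`, extended by `X₀ = 0`. -/
def genX (n : ℕ) : FockSpace := if h : 0 < n then MvPolynomial.X (n.toPNat h) else 0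

theorem genX_coe (n : ℕ+) : genX n = MvPolynomial.X n := by
  rw [genX, dif_pos n.pos]
  rfl

theorem smul_coeff_powerSumSeries (m n : ℕ) :
    (n : ℂ) • PowerSeries.coeff n (powerSumSeries m) = sqrtTwoM m • genX n := by
  rw [powerSumSeries, PowerSeries.coeff_mk, genX]
  split_ifs with h
  · rw [smul_smul, mul_div_cancel₀ _ (by exact_mod_cast h.ne')]
  · simp

/-- This is Newton's recursion. Exchanging the roles of the `X` and the `H` in it yields the
recursion that defines `invH`, hence the two substitutions are mutually inverse. -/
theorem completeH_eq_sum {m : ℕ} (hm : 0 < m) (n : ℕ) : (n / sqrtTwoM m) • completeH m n =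
    ∑ k ∈ Finset.range n, genX k * completeH m (n - k) + genX n := by
  refine smul_right_injective FockSpace (sqrtTwoM_ne_zero hm) ?_
  simp only
  rw [smul_smul, mul_div_cancel₀ _ (sqrtTwoM_ne_zero hm), completeH_rec,
    Finset.Nat.sum_antidiagonal_eq_sum_range_succ_mk, Finset.sum_range_succ, smul_add,
    Finset.smul_sum]
  simp only [← smul_mul_assoc, smul_coeff_powerSumSeries, Nat.sub_self, completeH_zero, mul_one]

/-- The algebra endomorphism `Xₙ ↦ Hₙ` of the Fock space. -/
def substH (m : ℕ) : FockSpace →ₐ[ℂ] FockSpace := MvPolynomial.aeval fun n => completeH m n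

/-- The expression of `Xₙ` as a polynomial in `H₁, …, Hₙ`. -/
def invH (m : ℕ) (n : ℕ) : FockSpace :=
  (n / sqrtTwoM m) • genX n - ∑ k : Fin n, invH m k * genX (n - k)
termination_by n
decreasing_by exact k.2

theorem invH_eq (m n : ℕ) : (n / sqrtTwoM m) • genX n =
    ∑ k ∈ Finset.range n, invH m k * genX (n - k) + invH m n := by
  rw [invH, Finset.sum_range fun k => invH m k * genX (n - k)]
  abel

theorem invH_zero (m : ℕ) : invH m 0 = 0 := by
  have := invH_eq m 0
  simpa using this.symm

/-- The inverse of `substH`. -/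
def substInvH (m : ℕ) : FockSpace →ₐ[ℂ] FockSpace := MvPolynomial.aeval fun n => invH m n

theorem substH_genX (m : ℕ) {n : ℕ} (hn : 0 < n) : substH m (genX n) = completeH m n := by
  rw [genX, dif_pos hn, substH, MvPolynomial.aeval_X]
  rfl

theorem substInvH_genX (m n : ℕ) : substInvH m (genX n) = invH m n := by
  rw [genX]
  split_ifs with h
  · rw [substInvH, MvPolynomial.aeval_X]
    rfl
  · rw [Nat.eq_zero_of_not_pos h, invH_zero, map_zero]

theorem substH_invH {m : ℕ} (hm : 0 < m) (n : ℕ) : substH m (invH m n) = genX n := by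
  induction n using Nat.strong_induction_on with
  | _ n ih =>
    rcases Nat.eq_zero_or_pos n with rfl | hn
    · rw [invH_zero, map_zero, genX, dif_neg (lt_irrefl 0)]
    have h := congrArg (substH m) (invH_eq m n)
    rw [map_smul, substH_genX m hn, completeH_eq_sum hm, map_add, map_sum] at h
    have e : ∀ k ∈ Finset.range n, substH m (invH m k * genX (n - k)) =
        genX k * completeH m (n - k) := by
      intro k hk
      rw [Finset.mem_range] at hk
      rw [map_mul, ih k hk, substH_genX m (by omega)]
    rw [Finset.sum_congr rfl e] at h
    exact (add_left_cancel h).symm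

theorem substInvH_completeH {m : ℕ} (hm : 0 < m) {n : ℕ} (hn : 0 < n) :
    substInvH m (completeH m n) = genX n := by
  induction n using Nat.strong_induction_on with
  | _ n ih =>
    have hc : (n / sqrtTwoM m : ℂ) ≠ 0 :=
      div_ne_zero (by exact_mod_cast hn.ne') (sqrtTwoM_ne_zero hm)
    refine smul_right_injective FockSpace hc ?_
    simp only
    rw [← map_smul, completeH_eq_sum hm, invH_eq, map_add, map_sum, substInvH_genX]
    congr 1
    refine Finset.sum_congr rfl fun k hk => ?_
    rw [Finset.mem_range] at hk
    rw [map_mul, substInvH_genX]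
    rcases Nat.eq_zero_or_pos k with rfl | hk0
    · rw [invH_zero, zero_mul, zero_mul]
    · rw [ih (n - k) (by omega) (by omega)]

/-- The automorphism `Xₙ ↦ Hₙ` of the Fock space. -/
def substHEquiv {m : ℕ} (hm : 0 < m) : FockSpace ≃ₐ[ℂ] FockSpace :=
  AlgEquiv.ofAlgHom (substH m) (substInvH m)
    (by
      refine MvPolynomial.algHom_ext fun n => ?_
      rw [AlgHom.comp_apply, ← genX_coe, substInvH_genX, substH_invH hm]
      rfl)
    (by
      refine MvPolynomial.algHom_ext fun n => ?_
      rw [AlgHom.comp_apply, ← genX_coe, substH_genX m n.pos, substInvH_completeH hm n.pos]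
      rfl)

/-- The basis of the Fock space that consists of the monomials in the `Hₙ`. -/
def basisH {m : ℕ} (hm : 0 < m) : Module.Basis (Multiset ℕ+) ℂ FockSpace :=
  ((MvPolynomial.basisMonomials ℕ+ ℂ).map (substHEquiv hm).toLinearEquiv).reindex
    Multiset.toFinsupp.symm.toEquiv

theorem basisH_apply {m : ℕ} (hm : 0 < m) (M : Multiset ℕ+) :
    basisH hm M = (M.map fun n : ℕ+ => completeH m n).prod := by
  have h : MvPolynomial.monomial (Multiset.toFinsupp M) (1 : ℂ) =
      (M.map fun n : ℕ+ => MvPolynomial.X n).prod := by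
    induction M using Multiset.induction_on with
    | empty => simp
    | cons a M ih =>
      rw [Multiset.map_cons, Multiset.prod_cons, ← ih, ← Multiset.singleton_add, map_add,
        Multiset.toFinsupp_singleton, MvPolynomial.X, MvPolynomial.monomial_mul, one_mul]
  rw [basisH, Module.Basis.reindex_apply, Module.Basis.map_apply,
    MvPolynomial.coe_basisMonomials]
  change substH m (MvPolynomial.monomial (Multiset.toFinsupp M) 1) = _
  rw [h, map_multiset_prod, Multiset.map_map]
  congr 1
  refine Multiset.map_congr rfl fun n _ => ?_
  rw [Function.comp_apply, substH, MvPolynomial.aeval_X]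

/-! ### Unitriangular families -/

/-- The map `T` sending `B` to `w` differs from the identity by a map that lowers the exhaustive
filtration `F`. Since `F 0 = 0`, induction along `F` gives injectivity and surjectivity; no level
has to be finite-dimensional. -/
theorem exists_basis_of_unitriangular {ι M : Type*} [AddCommGroup M] [Module ℂ M]
    (B : Module.Basis ι ℂ M) (f : ι → ℕ) (w : ι → M)
    (h : ∀ x, w x - B x ∈ Submodule.span ℂ (B '' {y | f y < f x})) :
    ∃ b : Module.Basis ι ℂ M, ⇑b = w := by
  let T : M →ₗ[ℂ] M := B.constr ℂ w
  let F : ℕ → Submodule ℂ M := fun n => Submodule.span ℂ (B '' {y | f y < n})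
  have hF : Monotone F := fun a b hab =>
    Submodule.span_mono (Set.image_mono fun y (hy : f y < a) => hy.trans_le hab)
  have hT : ∀ n, ∀ x ∈ F (n + 1), T x - x ∈ F n := by
    intro n x hx
    have : F (n + 1) ≤ (F n).comap (T - LinearMap.id) := by
      refine Submodule.span_le.2 ?_
      rintro _ ⟨y, hy, rfl⟩
      change T (B y) - B y ∈ F n
      rw [Module.Basis.constr_basis]
      exact hF (Nat.lt_succ_iff.1 hy) (h y)
    exact this hx
  have h0 : F 0 = ⊥ := by simp [F]
  have hex : ∀ x, ∃ n, x ∈ F n := by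
    intro x
    induction B.mem_span x using Submodule.span_induction with
    | mem x hx =>
      obtain ⟨y, rfl⟩ := hx
      exact ⟨f y + 1, Submodule.subset_span ⟨y, Nat.lt_succ_self _, rfl⟩⟩
    | zero => exact ⟨0, zero_mem _⟩
    | add x y _ _ hx hy =>
      obtain ⟨a, ha⟩ := hx
      obtain ⟨b, hb⟩ := hy
      exact ⟨max a b, add_mem (hF (le_max_left _ _) ha) (hF (le_max_right _ _) hb)⟩
    | smul c x _ hx =>
      obtain ⟨a, ha⟩ := hx
      exact ⟨a, Submodule.smul_mem _ _ ha⟩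
  have hinj : Function.Injective T := by
    rw [injective_iff_map_eq_zero]
    intro x hx
    obtain ⟨n, hn⟩ := hex x
    induction n with
    | zero => rwa [h0, Submodule.mem_bot] at hn
    | succ n ih =>
      have := hT n x hn
      rw [hx, zero_sub, neg_mem_iff] at this
      exact ih this
  have hsurj : Function.Surjective T := by
    intro x
    obtain ⟨n, hn⟩ := hex x
    induction n generalizing x with
    | zero =>
      rw [h0, Submodule.mem_bot] at hn
      exact ⟨0, by rw [hn, map_zero]⟩
    | succ n ih =>
      obtain ⟨y, hy⟩ := ih _ (hT n x hn)
      exact ⟨x - y, by rw [map_sub, hy, sub_sub_cancel]⟩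
  have hbij : Function.Bijective T := ⟨hinj, hsurj⟩
  refine ⟨B.map (LinearEquiv.ofBijective T hbij), ?_⟩
  funext x
  rw [Module.Basis.map_apply, LinearEquiv.ofBijective_apply, Module.Basis.constr_basis]

/-! ### Vectors labeled by lists of exponents -/

/-- The product `H_{e₁} H_{e₂} ⋯`. -/
def listH (m : ℕ) (e : List ℕ) : FockSpace := (e.map (completeH m)).prod

theorem listH_cons (m a : ℕ) (e : List ℕ) : listH m (a :: e) = completeH m a * listH m e := by
  simp [listH]

/-- The vector obtained from the vacuum by successive application of the components `vertexOp` of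
degrees given by the list (the last one acts first). -/
def fockVector (m : ℕ) : List ℕ → FockSpace
  | [] => 1
  | t :: l => vertexOp m t (fockVector m l)

theorem vertexOp_one (m : ℕ) (t : ℤ) : vertexOp m t 1 = completeHInt m t := by
  have h : ∀ s ≥ 1, shiftCoeff m s 1 = 0 := by
    intro s hs
    have := shiftCoeff_completeHInt m s 0
    rwa [completeHInt_neg (by omega : (0 : ℤ) - s < 0), smul_zero, ← Nat.cast_zero,
      completeHInt_natCast, completeH_zero] at this
  rw [vertexOp_apply m t 1 h]
  simp [shiftCoeff_zero]

/-- Passing the operator through the factors one at a time moves degree from them to the new first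
entry; the only term without a move is `H_t` times the old product. -/
theorem vertexOp_listH (m t : ℕ) (e : List ℕ) :
    vertexOp m t (listH m e) - listH m (t :: e) ∈ Submodule.span ℂ (listH m ''
      {l | ∃ s e', 0 < s ∧ List.Forall₂ (· ≤ ·) e' e ∧ e'.sum + s = e.sum ∧
        l = (t + s) :: e'}) := by
  induction e generalizing t with
  | nil =>
    have : vertexOp m t (listH m []) - listH m [t] = 0 := by
      simp [listH, vertexOp_one, completeHInt_natCast]
    rw [this]
    exact zero_mem _
  | cons r e ih =>
    rw [listH_cons, ← completeHInt_natCast m r, vertexOp_completeHInt_mul, Finset.sum_range_succ',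
      add_sub_assoc]
    refine add_mem (sum_mem fun x _ => Submodule.smul_mem _ _ ?_) ?_
    -- Here `x + 1` is the degree taken from `r`; taking more than `r` gives zero.
    · rcases lt_or_ge r (x + 1) with hx | hx
      · rw [completeHInt_neg (by omega), zero_mul]
        exact zero_mem _
      have e1 : (r : ℤ) - (x + 1 : ℕ) = (r - (x + 1) : ℕ) := by omega
      have e2 : (t : ℤ) + (x + 1 : ℕ) = (t + (x + 1) : ℕ) := by omega
      rw [e1, e2, completeHInt_natCast,
        ← sub_add_cancel (vertexOp m (t + (x + 1) : ℕ) (listH m e)) (listH m ((t + (x + 1)) :: e)),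
        mul_add]
      refine add_mem ?_ (Submodule.subset_span ⟨(t + (x + 1)) :: (r - (x + 1)) :: e,
        ⟨x + 1, (r - (x + 1)) :: e, by omega, .cons (by omega) ?_, ?_, rfl⟩, ?_⟩)
      · have := Submodule.mem_map_of_mem (f := LinearMap.mulLeft ℂ (completeH m (r - (x + 1))))
          (ih (t + (x + 1)))
        rw [Submodule.map_span] at this
        refine Submodule.span_mono ?_ this
        rintro _ ⟨_, ⟨_, ⟨s, e', hs, he, hsum, rfl⟩, rfl⟩, rfl⟩
        refine ⟨(t + (x + 1 + s)) :: (r - (x + 1)) :: e', ⟨x + 1 + s, (r - (x + 1)) :: e', by omega,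
          .cons (by omega) he, ?_, rfl⟩, ?_⟩
        · simp only [List.sum_cons]
          omega
        · rw [LinearMap.mulLeft_apply]
          simp only [listH_cons, add_assoc]
          ring
      · exact List.forall₂_same.2 fun _ _ => le_rfl
      · simp only [List.sum_cons]
        omega
      · simp only [listH_cons]
        ring
    -- The summand that takes nothing from `r` carries the leading term.
    · have e0 : altChoose m 0 • (completeHInt m (r - (0 : ℕ)) *
          vertexOp m (t + (0 : ℕ)) (listH m e)) - listH m (t :: r :: e) =
          completeH m r * (vertexOp m t (listH m e) - listH m (t :: e)) := by
        simp only [altChoose, listH_cons, Nat.cast_zero, sub_zero, add_zero, completeHInt_natCast,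
          pow_zero, Nat.choose_zero_right, Nat.cast_one, mul_one, one_smul]
        ring
      rw [e0]
      have := Submodule.mem_map_of_mem (f := LinearMap.mulLeft ℂ (completeH m r)) (ih t)
      rw [Submodule.map_span] at this
      refine Submodule.span_mono ?_ this
      rintro _ ⟨_, ⟨_, ⟨s, e', hs, he, hsum, rfl⟩, rfl⟩, rfl⟩
      refine ⟨(t + s) :: r :: e', ⟨s, r :: e', hs, .cons le_rfl he, ?_, rfl⟩, ?_⟩
      · simp only [List.sum_cons]
        omega
      · rw [LinearMap.mulLeft_apply]
        simp only [listH_cons]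
        ring

/-- `SuffixLE e l` says that `e` and `l` have the same length and that the sum of every suffix of
`e` is at most the sum of the corresponding suffix of `l`. -/
inductive SuffixLE : List ℕ → List ℕ → Prop
  | nil : SuffixLE [] []
  | cons {a b : ℕ} {e l : List ℕ} (h : SuffixLE e l) (hab : a + e.sum ≤ b + l.sum) :
      SuffixLE (a :: e) (b :: l)

theorem SuffixLE.sum_le {e l : List ℕ} (h : SuffixLE e l) : e.sum ≤ l.sum := by
  cases h with
  | nil => exact le_rfl
  | cons h hab => simpa using hab

theorem SuffixLE.of_forall₂ {e' e l : List ℕ} (h : List.Forall₂ (· ≤ ·) e' e)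
    (hl : SuffixLE e l) : SuffixLE e' l := by
  induction hl generalizing e' with
  | nil =>
    cases h
    exact .nil
  | cons hl hab ih =>
    cases h with
    | cons h1 h2 =>
      refine .cons (ih h2) ?_
      have : List.sum _ ≤ List.sum _ := List.Forall₂.sum_le_sum h2
      omega

/-- Degree only moves towards the front, so suffix sums never grow while the total stays fixed.
Reflexivity of `SuffixLE` is carried along since the leading term needs it. -/
theorem fockVector_sub_listH (m : ℕ) (l : List ℕ) :
    fockVector m l - listH m l ∈ Submodule.span ℂ (listH m ''
      {e | SuffixLE e l ∧ e.sum = l.sum ∧ e ≠ l}) ∧ SuffixLE l l := by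
  induction l with
  | nil =>
    refine ⟨?_, .nil⟩
    have : fockVector m [] - listH m [] = 0 := by simp [fockVector, listH]
    rw [this]
    exact zero_mem _
  | cons t l ih =>
    obtain ⟨ih, hl⟩ := ih
    refine ⟨?_, .cons hl le_rfl⟩
    have key : ∀ e, SuffixLE e l → e.sum = l.sum →
        vertexOp m t (listH m e) - listH m (t :: e) ∈ Submodule.span ℂ (listH m ''
          {e | SuffixLE e (t :: l) ∧ e.sum = (t :: l).sum ∧ e ≠ t :: l}) := by
      intro e he hsum
      refine Submodule.span_mono (Set.image_mono ?_) (vertexOp_listH m t e)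
      rintro _ ⟨s, e', hs, he', hsum', rfl⟩
      refine ⟨.cons (.of_forall₂ he' he) (by omega), ?_, ?_⟩
      · simp only [List.sum_cons]
        omega
      · intro h
        have := (List.cons.inj h).1
        omega
    rw [fockVector, ← sub_add_cancel (fockVector m l) (listH m l), map_add, add_sub_assoc]
    refine add_mem ?_ (key l hl rfl)
    have hle : Submodule.span ℂ (listH m '' {e | SuffixLE e l ∧ e.sum = l.sum ∧ e ≠ l}) ≤
        (Submodule.span ℂ (listH m ''
          {e | SuffixLE e (t :: l) ∧ e.sum = (t :: l).sum ∧ e ≠ t :: l})).comap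
          (vertexOp m t) := by
      refine Submodule.span_le.2 ?_
      rintro _ ⟨e, ⟨he, hsum, hne⟩, rfl⟩
      rw [SetLike.mem_coe, Submodule.mem_comap,
        ← sub_add_cancel (vertexOp m t (listH m e)) (listH m (t :: e))]
      refine add_mem (key e he hsum) (Submodule.subset_span ⟨t :: e, ⟨.cons he ?_, ?_, ?_⟩, rfl⟩)
      · omega
      · simp only [List.sum_cons]
        omega
      · intro h
        exact hne (List.cons.inj h).2
    exact hle ih

/-! ### The sum of squares separates -/

/-- The sum of the squares of the members of a list. -/
def sumSq (e : List ℕ) : ℕ := (e.map fun x => x ^ 2).sum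

theorem sumSq_cons (a : ℕ) (e : List ℕ) : sumSq (a :: e) = a ^ 2 + sumSq e := by
  simp [sumSq]

/-- By convexity `e_j² - l_j² ≥ 2 l_j (e_j - l_j)`, strictly unless `e_j = l_j`. Abel summation over
the suffix sums of `e - l`, all nonpositive, bounds the total because `l` decreases. The bound `a`
on the entries of `l` makes the induction work and drops out when the sums agree. -/
theorem SuffixLE.sum_sq {e l : List ℕ} (h : SuffixLE e l) (a : ℕ)
    (ha : ∀ x ∈ l, x ≤ a) (hl : l.Pairwise (· ≥ ·)) :
    2 * (a : ℤ) * ((e.sum : ℤ) - l.sum) ≤ (sumSq e : ℤ) - sumSq l ∧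
      (e ≠ l → 2 * (a : ℤ) * ((e.sum : ℤ) - l.sum) < (sumSq e : ℤ) - sumSq l) := by
  induction h generalizing a with
  | nil => simp
  | @cons x y e l h hxy ih =>
    rw [List.pairwise_cons] at hl
    obtain ⟨h1, h2⟩ := ih y hl.1 hl.2
    have hya : (y : ℤ) ≤ a := by exact_mod_cast ha y (by simp)
    have hS : (x : ℤ) + e.sum - (y + l.sum) ≤ 0 := by omega
    simp only [List.sum_cons, sumSq_cons, ne_eq, List.cons.injEq, Nat.cast_add, Nat.cast_pow]
    have h3 := mul_nonneg_of_nonpos_of_nonpos hS (sub_nonpos.2 hya)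
    refine ⟨by nlinarith [sq_nonneg ((x : ℤ) - y)], fun hne => ?_⟩
    by_cases hxy' : x = y
    · have := h2 fun h => hne ⟨hxy', h⟩
      subst hxy'
      nlinarith
    · have h4 : (x : ℤ) - y ≠ 0 := by omega
      have := sq_pos_of_ne_zero h4
      nlinarith

theorem SuffixLE.sum_sq_lt {e l : List ℕ} (h : SuffixLE e l) (hl : l.Pairwise (· ≥ ·))
    (hsum : e.sum = l.sum) (hne : e ≠ l) :
    sumSq l < sumSq e := by
  have := (h.sum_sq l.sum (fun x hx => List.single_le_sum (by simp) x hx) hl).2 hne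
  rw [hsum, sub_self, mul_zero] at this
  omega

/-- This keeps the natural subtraction in `defect` from truncating. -/
theorem sum_sq_le_sq_sum (e : List ℕ) : sumSq e ≤ e.sum ^ 2 := by
  induction e with
  | nil => simp [sumSq]
  | cons a e ih =>
    simp only [sumSq_cons, List.sum_cons]
    nlinarith [Nat.zero_le (a * e.sum)]

/-! ### Positive parts -/

/-- The list of the positive members of a list. -/
def posParts : List ℕ → List ℕ+
  | [] => []
  | a :: l => if h : 0 < a then a.toPNat h :: posParts l else posParts l

theorem prod_posParts {M : Type*} [CommMonoid M] (g : ℕ → M) (h0 : g 0 = 1) (e : List ℕ) :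
    ((posParts e : Multiset ℕ+).map fun n : ℕ+ => g n).prod = (e.map g).prod := by
  induction e with
  | nil => simp [posParts]
  | cons a e ih =>
    rw [posParts]
    split_ifs with h
    · rw [← Multiset.cons_coe, Multiset.map_cons, Multiset.prod_cons, ih, List.map_cons,
        List.prod_cons]
      rfl
    · rw [ih, List.map_cons, List.prod_cons, Nat.eq_zero_of_not_pos h, h0, one_mul]

theorem sum_posParts {M : Type*} [AddCommMonoid M] (g : ℕ → M) (h0 : g 0 = 0) (e : List ℕ) :
    ((posParts e : Multiset ℕ+).map fun n : ℕ+ => g n).sum = (e.map g).sum :=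
  prod_posParts (M := Multiplicative M) g h0 e

theorem posParts_map_coe (L : List ℕ+) : posParts (L.map fun n : ℕ+ => (n : ℕ)) = L := by
  induction L with
  | nil => rfl
  | cons a L ih =>
    rw [List.map_cons, posParts, dif_pos a.pos, ih]
    rfl

theorem listH_eq_basisH {m : ℕ} (hm : 0 < m) (e : List ℕ) :
    listH m e = basisH hm (posParts e) := by
  rw [basisH_apply, prod_posParts _ (completeH_zero m), listH]

/-- The parts of a multiset in decreasing order. -/
def sortedParts (M : Multiset ℕ+) : List ℕ := (M.sort (· ≥ ·)).map fun n : ℕ+ => (n : ℕ)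

theorem posParts_sortedParts (M : Multiset ℕ+) : (posParts (sortedParts M) : Multiset ℕ+) = M := by
  rw [sortedParts, posParts_map_coe, Multiset.sort_eq]

theorem pairwise_sortedParts (M : Multiset ℕ+) : (sortedParts M).Pairwise (· ≥ ·) := by
  rw [sortedParts, List.pairwise_map]
  exact (Multiset.pairwise_sort M (· ≥ ·)).imp fun h => h

/-- The degree squared minus the sum of the squares of the parts. -/
def defect (M : Multiset ℕ+) : ℕ :=
  (M.map fun n : ℕ+ => (n : ℕ)).sum ^ 2 - (M.map fun n : ℕ+ => (n : ℕ) ^ 2).sum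

theorem defect_posParts (e : List ℕ) :
    defect (posParts e) = e.sum ^ 2 - sumSq e := by
  rw [defect, sum_posParts (fun n => n) rfl, sum_posParts (fun n => n ^ 2) rfl, List.map_id', sumSq]

theorem fockVector_sub_basisH {m : ℕ} (hm : 0 < m) (M : Multiset ℕ+) :
    fockVector m (sortedParts M) - basisH hm M ∈
      Submodule.span ℂ (basisH hm '' {M' | defect M' < defect M}) := by
  have h := (fockVector_sub_listH m (sortedParts M)).1
  rw [listH_eq_basisH hm (sortedParts M), posParts_sortedParts] at h
  refine Submodule.span_mono ?_ h
  rintro _ ⟨e, ⟨he, hsum, hne⟩, rfl⟩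
  refine ⟨posParts e, ?_, (listH_eq_basisH hm e).symm⟩
  have h1 := he.sum_sq_lt (pairwise_sortedParts M) hsum hne
  have h2 := sum_sq_le_sq_sum e
  change defect _ < defect M
  rw [← posParts_sortedParts M, defect_posParts, defect_posParts, ← hsum]
  omega

/-- The vectors `fockVector` form a basis of the lattice module. -/
theorem exists_basis_fockVector {m : ℕ} (hm : 0 < m) (i : ℕ) :
    ∃ b : Module.Basis (Σ _ : ℤ, Multiset ℕ+) ℂ (LatticeModule m i),
      ⇑b = fun x => Finsupp.single x.1 (fockVector m (sortedParts x.2)) := by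
  refine exists_basis_of_unitriangular (Finsupp.basis fun _ => basisH hm)
    (fun x => defect x.2) _ ?_
  rintro ⟨k, M⟩
  rw [Finsupp.coe_basis]
  change Finsupp.single k _ - Finsupp.single k (basisH hm M) ∈ _
  rw [← Finsupp.single_sub]
  have := Submodule.mem_map_of_mem (f := Finsupp.lsingle (R := ℂ) k) (fockVector_sub_basisH hm M)
  rw [Submodule.map_span] at this
  refine Submodule.span_mono ?_ this
  rintro _ ⟨_, ⟨M', hM', rfl⟩, rfl⟩
  exact ⟨⟨k, M'⟩, hM', rfl⟩

/-! ### Admissible sequences and partitions -/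

theorem getD_le_getD_zero {a : ℕ} {l : List ℕ} (h : ∀ x ∈ l, x ≤ a) (u : ℕ) : l.getD u 0 ≤ a := by
  rcases lt_or_ge u l.length with hu | hu
  · rw [List.getD_eq_getElem _ _ hu]
    exact h _ (List.getElem_mem hu)
  · rw [List.getD_eq_default _ _ hu]
    exact Nat.zero_le a

theorem getD_succ_le {l : List ℕ} (h : l.Pairwise (· ≥ ·)) (u : ℕ) :
    l.getD (u + 1) 0 ≤ l.getD u 0 := by
  induction l generalizing u with
  | nil => simp
  | cons a l ih =>
    rw [List.pairwise_cons] at h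
    rcases u with _ | u
    · rw [List.getD_cons_succ, List.getD_cons_zero]
      exact getD_le_getD_zero h.1 0
    · rw [List.getD_cons_succ, List.getD_cons_succ]
      exact ih h.2 u

/-- The positions of the ones in the sequence of charge `k` that belongs to a partition. -/
def onePosition (m i : ℕ) (x : Σ _ : ℤ, Multiset ℕ+) (u : ℕ) : ℤ :=
  -i + 2 * m * (1 - x.1 + u) - 1 - ((sortedParts x.2).getD u 0 : ℕ)

open Classical in
/-- The sequence of charge `k` that belongs to a partition. -/
def partitionSeq (m i : ℕ) (x : Σ _ : ℤ, Multiset ℕ+) (j : ℤ) : ℕ :=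
  if ∃ u, onePosition m i x u = j then 1 else 0

theorem partitionSeq_ne_zero {m i : ℕ} {x : Σ _ : ℤ, Multiset ℕ+} {j : ℤ} :
    partitionSeq m i x j ≠ 0 ↔ ∃ u, onePosition m i x u = j := by
  simp [partitionSeq]

theorem onePosition_add_le (m i : ℕ) (x : Σ _ : ℤ, Multiset ℕ+) (u : ℕ) :
    onePosition m i x u + 2 * m ≤ onePosition m i x (u + 1) := by
  have := getD_succ_le (pairwise_sortedParts x.2) u
  have e : (2 : ℤ) * m * (1 - x.1 + (u + 1 : ℕ)) = 2 * m * (1 - x.1 + u) + 2 * m := by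
    push_cast
    ring
  rw [onePosition, onePosition, e]
  omega

theorem onePosition_strictMono {m : ℕ} (hm : 0 < m) (i : ℕ) (x : Σ _ : ℤ, Multiset ℕ+) :
    StrictMono (onePosition m i x) :=
  strictMono_nat_of_lt_succ fun u => by
    have := onePosition_add_le m i x u
    omega

theorem onePosition_of_length_le (m i : ℕ) (x : Σ _ : ℤ, Multiset ℕ+) {u : ℕ}
    (hu : (sortedParts x.2).length ≤ u) :
    onePosition m i x u = -i + 2 * m * (1 - x.1 + u) - 1 := by
  rw [onePosition, List.getD_eq_default _ _ hu, Nat.cast_zero, sub_zero]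

/-- The parts are positive, so the default value `0` detects the end of a list. -/
theorem eq_of_getD_eq {L L' : List ℕ+}
    (h : ∀ u, (L.map fun n : ℕ+ => (n : ℕ)).getD u 0 = (L'.map fun n : ℕ+ => (n : ℕ)).getD u 0) :
    L = L' := by
  induction L generalizing L' with
  | nil =>
    cases L' with
    | nil => rfl
    | cons b L' => exact absurd (h 0) (by simpa using b.pos.ne)
  | cons a L ih =>
    cases L' with
    | nil => exact absurd (h 0) (by simp)
    | cons b L' =>
      have h0 := h 0
      rw [List.map_cons, List.map_cons, List.getD_cons_zero, List.getD_cons_zero] at h0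
      rw [PNat.coe_injective h0, ih fun u => ?_]
      have := h (u + 1)
      rwa [List.map_cons, List.map_cons, List.getD_cons_succ, List.getD_cons_succ] at this

theorem partitionSeq_injective {m : ℕ} (hm : 0 < m) (i : ℕ) :
    Function.Injective (partitionSeq m i) := by
  rintro ⟨k, M⟩ ⟨k', M'⟩ h
  have hr : Set.range (onePosition m i ⟨k, M⟩) = Set.range (onePosition m i ⟨k', M'⟩) := by
    ext j
    rw [Set.mem_range, Set.mem_range, ← partitionSeq_ne_zero, ← partitionSeq_ne_zero, h]
  have he := ((onePosition_strictMono hm i _).range_inj (onePosition_strictMono hm i _)).1 hr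
  have hk : k = k' := by
    -- Beyond both lists the ones are undisplaced, and their position reveals the charge.
    have h1 := congrFun he (max (sortedParts M).length (sortedParts M').length)
    rw [onePosition_of_length_le _ _ _ (le_max_left _ _),
      onePosition_of_length_le _ _ _ (le_max_right _ _)] at h1
    have h2 : (2 * m : ℤ) ≠ 0 := by omega
    have h3 := mul_left_cancel₀ h2 (add_left_cancel (sub_left_injective h1))
    simp only at h3
    omega
  subst hk
  congr 1
  rw [← Multiset.sort_eq M (· ≥ ·), ← Multiset.sort_eq M' (· ≥ ·)]
  congr 1
  refine eq_of_getD_eq fun u => ?_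
  have h1 := congrFun he u
  simp only [onePosition] at h1
  exact_mod_cast sub_right_injective h1

theorem partitionSeq_isAdmissible {m : ℕ} (hm : 0 < m) (i : ℕ) (x : Σ _ : ℤ, Multiset ℕ+) :
    IsAdmissible m i (partitionSeq m i x) := by
  classical
  have hmono := onePosition_strictMono hm i x
  refine ⟨⟨1 - x.1 + (sortedParts x.2).length, fun k hk => ?_, fun j hj hdvd => ?_⟩,
    ⟨onePosition m i x 0, fun j hj => ?_⟩, fun j => ?_⟩
  · refine if_pos ⟨(k - 1 + x.1).toNat, ?_⟩
    rw [onePosition_of_length_le _ _ _ (by omega), Int.toNat_of_nonneg (by omega)]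
    ring
  · by_contra hne
    obtain ⟨u, rfl⟩ := partitionSeq_ne_zero.1 hne
    rw [← onePosition_of_length_le m i x le_rfl, hmono.le_iff_le] at hj
    apply hdvd
    rw [onePosition_of_length_le _ _ _ hj]
    exact ⟨1 - x.1 + u, by ring⟩
  · by_contra hne
    obtain ⟨u, rfl⟩ := partitionSeq_ne_zero.1 hne
    exact absurd (hmono.lt_iff_lt.1 hj) (Nat.not_lt_zero u)
  · have hgap : ∀ u v, u < v → onePosition m i x u + 2 * m ≤ onePosition m i x v := fun u v huv =>
      (onePosition_add_le m i x u).trans (hmono.monotone huv)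
    simp only [partitionSeq]
    rw [Finset.sum_boole, Nat.cast_id, Finset.card_le_one]
    intro a ha b hb
    rw [Finset.mem_filter, Finset.mem_range] at ha hb
    obtain ⟨ha, u, hu⟩ := ha
    obtain ⟨hb, v, hv⟩ := hb
    rcases lt_trichotomy u v with h | h | h
    · have := hgap u v h
      omega
    · subst h
      omega
    · have := hgap v u h
      omega

/-! ### Monomial vectors -/

theorem modeMonomial_self (m i : ℕ) (s : ℤ → ℕ) (M : ℤ) : modeMonomial m i s M M = 1 := by
  simp [modeMonomial]

theorem modeMonomial_sub_one (m i : ℕ) (s : ℤ → ℕ) {N M : ℤ} (h : N ≤ M) :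
    modeMonomial m i s (N - 1) M = mode m i (N - 1) ^ s (N - 1) * modeMonomial m i s N M := by
  have e : (M - (N - 1)).toNat = (M - N).toNat + 1 := by omega
  rw [modeMonomial, modeMonomial, e, List.range_succ_eq_map, List.map_cons, List.prod_cons,
    List.map_map, Nat.cast_zero, add_zero]
  congr 2
  refine List.map_congr_left fun t _ => ?_
  have : N - 1 + (t.succ : ℕ) = N + t := by
    push_cast
    ring
  rw [Function.comp_apply, this]

theorem add_le_of_ne_zero {m : ℕ} {s : ℤ → ℕ}
    (hs : ∀ j : ℤ, ∑ t ∈ Finset.range (2 * m), s (j + t) ≤ 1) {j j' : ℤ} (h : j < j')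
    (hj : s j ≠ 0) (hj' : s j' ≠ 0) : j + 2 * m ≤ j' := by
  by_contra hlt
  have h1 : ∑ t ∈ {0, (j' - j).toNat}, s (j + (t : ℕ)) ≤
      ∑ t ∈ Finset.range (2 * m), s (j + t) := by
    refine Finset.sum_le_sum_of_subset ?_
    intro t ht
    rw [Finset.mem_insert, Finset.mem_singleton] at ht
    rw [Finset.mem_range]
    omega
  rw [Finset.sum_pair (by omega), Nat.cast_zero, add_zero, Int.toNat_of_nonneg (by omega),
    add_sub_cancel] at h1
  have := hs j
  omega

theorem le_one_of_window {m : ℕ} (hm : 0 < m) {s : ℤ → ℕ}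
    (hs : ∀ j : ℤ, ∑ t ∈ Finset.range (2 * m), s (j + t) ≤ 1) (j : ℤ) : s j ≤ 1 := by
  have h1 := Finset.single_le_sum (f := fun t : ℕ => s (j + t)) (fun _ _ => Nat.zero_le _)
    (Finset.mem_range.2 (by omega : 0 < 2 * m))
  simp only [Nat.cast_zero, add_zero] at h1
  exact h1.trans (hs j)

/-- The positions of the ones that belong to a list of exponents. -/
def listPosition (m : ℕ) (M : ℤ) (l : List ℕ) (u : ℕ) : ℤ :=
  M - 1 - 2 * m * (l.length - 1 - u) - (l.getD u 0 : ℕ)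

/-- The positions left of `M` are read from right to left, and each one of `s` adds a head to the
list of degrees. The list may contain zeros, from ones in ground-state position. -/
theorem exists_list_modeMonomial {m : ℕ} (hm : 0 < m) (i : ℕ) {s : ℤ → ℕ}
    (hs : ∀ j : ℤ, ∑ t ∈ Finset.range (2 * m), s (j + t) ≤ 1) (n : ℤ) {M : ℤ}
    (hM : M = -i + 2 * m * n) (q : ℕ) :
    ∃ l : List ℕ, l.Pairwise (· ≥ ·) ∧
      modeMonomial m i s (M - q) M (extremalVector m i n) =
        Finsupp.single (-n + l.length) (fockVector m l) ∧
      (∀ u < l.length, M - q ≤ listPosition m M l u ∧ s (listPosition m M l u) ≠ 0) ∧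
      ∀ j, M - q ≤ j → j < M → s j ≠ 0 → ∃ u < l.length, listPosition m M l u = j := by
  induction q with
  | zero =>
    refine ⟨[], .nil, ?_, by simp, fun j h1 h2 => by omega⟩
    rw [Nat.cast_zero, sub_zero, modeMonomial_self]
    simp [extremalVector, fockVector]
  | succ q ih =>
    obtain ⟨l, hl, hv, hpos, hex⟩ := ih
    have eq : M - (q + 1 : ℕ) = M - q - 1 := by
      push_cast
      ring
    rw [eq, modeMonomial_sub_one m i s (by omega), Module.End.mul_apply, hv]
    have hle := le_one_of_window hm hs (M - q - 1)
    rcases Nat.eq_zero_or_pos (s (M - q - 1)) with h0 | h1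
    · refine ⟨l, hl, by rw [h0, pow_zero, Module.End.one_apply], fun u hu => ?_,
        fun j hj hjM hne => ?_⟩
      · have := hpos u hu
        exact ⟨by omega, this.2⟩
      · refine hex j ?_ hjM hne
        by_contra hlt
        have : j = M - q - 1 := by omega
        exact hne (this ▸ h0)
    · have h1' : s (M - q - 1) = 1 := by omega
      -- `t` is the degree of the mode at `M - q - 1` on the summand reached so far. The gap of at
      -- least `2m` to the next one makes it nonnegative and no smaller than the previous head.
      have hhead : ∃ t : ℕ, (t : ℤ) = q - 2 * m * l.length ∧ ∀ y ∈ l, y ≤ t := by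
        cases l with
        | nil => exact ⟨q, by simp, by simp⟩
        | cons a l =>
          have hp := hpos 0 (by simp)
          have hg := add_le_of_ne_zero hs (by omega) h1.ne' hp.2
          simp only [listPosition, List.length_cons, List.getD_cons_zero] at hg
          have ex : (2 : ℤ) * m * ((l.length + 1 : ℕ) - 1 - (0 : ℕ)) =
              2 * m * (l.length + 1 : ℕ) - 2 * m := by
            push_cast
            ring
          rw [ex] at hg
          refine ⟨(q - 2 * m * (l.length + 1 : ℕ) : ℤ).toNat, ?_, ?_⟩
          · rw [List.length_cons]
            omega
          · intro y hy
            have : y ≤ a := by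
              rcases List.mem_cons.1 hy with rfl | hy
              · exact le_rfl
              · exact (List.pairwise_cons.1 hl).1 y hy
            omega
      obtain ⟨t, ht, hlt⟩ := hhead
      have hzero : listPosition m M (t :: l) 0 = M - q - 1 := by
        rw [listPosition, List.getD_cons_zero, List.length_cons, ht]
        push_cast
        ring
      have hsucc : ∀ u, listPosition m M (t :: l) (u + 1) = listPosition m M l u := by
        intro u
        rw [listPosition, listPosition, List.getD_cons_succ, List.length_cons]
        push_cast
        ring
      refine ⟨t :: l, List.pairwise_cons.2 ⟨hlt, hl⟩, ?_, ?_, ?_⟩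
      · rw [h1', pow_one, mode_single, fockVector, List.length_cons]
        have e1 : -(M - q - 1) - 1 - (2 * m * (-n + l.length) + i) = t := by
          rw [hM, ht]
          ring
        rw [e1]
        congr 1
        push_cast
        ring
      · rintro (_ | u) hu
        · rw [hzero]
          exact ⟨le_rfl, h1.ne'⟩
        · rw [hsucc]
          have := hpos u (by simpa using hu)
          exact ⟨by omega, this.2⟩
      · intro j hj hjM hne
        rcases eq_or_lt_of_le hj with rfl | hj
        · exact ⟨0, by simp, hzero⟩
        · obtain ⟨u, hu, rfl⟩ := hex j (by omega) hjM hne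
          exact ⟨u + 1, by simpa using hu, hsucc u⟩

/-! ### Removing zero parts, and the match of sequences with partitions -/

theorem posParts_of_forall_eq_zero {l : List ℕ} (h : ∀ y ∈ l, y ≤ 0) : posParts l = [] := by
  induction l with
  | nil => rfl
  | cons a l ih =>
    rw [posParts, dif_neg (Nat.not_lt.2 (h a (by simp))), ih fun y hy => h y (by simp [hy])]

theorem mem_of_mem_posParts {l : List ℕ} {y : ℕ+} (h : y ∈ posParts l) : (y : ℕ) ∈ l := by
  induction l with
  | nil => simp [posParts] at h
  | cons a l ih =>
    rw [posParts] at h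
    split_ifs at h with ha
    · rcases List.mem_cons.1 h with rfl | h
      · exact List.mem_cons_self
      · exact List.mem_cons_of_mem _ (ih h)
    · exact List.mem_cons_of_mem _ (ih h)

theorem pairwise_posParts {l : List ℕ} (h : l.Pairwise (· ≥ ·)) :
    (posParts l).Pairwise (· ≥ ·) := by
  induction l with
  | nil => exact .nil
  | cons a l ih =>
    rw [List.pairwise_cons] at h
    rw [posParts]
    split_ifs with ha
    · exact List.pairwise_cons.2 ⟨fun y hy => h.1 _ (mem_of_mem_posParts hy), ih h.2⟩
    · exact ih h.2

theorem sortedParts_posParts {l : List ℕ} (h : l.Pairwise (· ≥ ·)) :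
    sortedParts (posParts l) = (posParts l).map fun n : ℕ+ => (n : ℕ) := by
  rw [sortedParts]
  congr 1
  refine List.Perm.eq_of_pairwise (fun a b _ _ h1 h2 => le_antisymm h2 h1)
    (Multiset.pairwise_sort _ _) (pairwise_posParts h) ?_
  rw [← Multiset.coe_eq_coe, Multiset.sort_eq]

theorem getD_sortedParts_posParts {l : List ℕ} (h : l.Pairwise (· ≥ ·)) (u : ℕ) :
    (sortedParts (posParts l)).getD u 0 = l.getD u 0 := by
  rw [sortedParts_posParts h]
  induction l generalizing u with
  | nil => rfl
  | cons a l ih =>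
    rw [List.pairwise_cons] at h
    rw [posParts]
    split_ifs with ha
    · rcases u with _ | u
      · rfl
      · rw [List.map_cons, List.getD_cons_succ, List.getD_cons_succ, ih h.2]
    · obtain rfl := Nat.eq_zero_of_not_pos ha
      rw [ih h.2]
      have h1 := getD_le_getD_zero h.1
      rcases u with _ | u
      · rw [List.getD_cons_zero]
        exact Nat.le_zero.1 (h1 0)
      · rw [List.getD_cons_succ, Nat.le_zero.1 (h1 _), Nat.le_zero.1 (h1 _)]

/-- In a decreasing list the zeros come last, so they act directly on the vacuum and fix it, as `H₀
= 1`. Hence the choice of `n` does not matter. -/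
theorem fockVector_sortedParts_posParts (m : ℕ) {l : List ℕ} (h : l.Pairwise (· ≥ ·)) :
    fockVector m (sortedParts (posParts l)) = fockVector m l := by
  rw [sortedParts_posParts h]
  induction l with
  | nil => rfl
  | cons a l ih =>
    rw [List.pairwise_cons] at h
    rw [posParts]
    split_ifs with ha
    · rw [List.map_cons, fockVector, fockVector, ih h.2]
      rfl
    · obtain rfl := Nat.eq_zero_of_not_pos ha
      have h1 := ih h.2
      rw [posParts_of_forall_eq_zero h.1] at h1 ⊢
      rw [fockVector, ← h1, List.map_nil, fockVector, vertexOp_one, completeHInt_natCast,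
        completeH_zero]

/-- Every monomial vector of an admissible sequence is the vector of the partition that belongs to
the sequence. -/
theorem exists_partition_modeMonomial {m : ℕ} (hm : 0 < m) (i : ℕ) {s : ℤ → ℕ}
    (hs : ∀ j : ℤ, ∑ t ∈ Finset.range (2 * m), s (j + t) ≤ 1) {n N : ℤ}
    (hn : PeriodicFrom m i s n) (hN : ∀ j < N, s j = 0) :
    ∃ x : Σ _ : ℤ, Multiset ℕ+, partitionSeq m i x = s ∧
      modeMonomial m i s N (-i + 2 * m * n) (extremalVector m i n) =
        Finsupp.single x.1 (fockVector m (sortedParts x.2)) := by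
  obtain ⟨M, hM⟩ : ∃ M : ℤ, M = -i + 2 * m * n := ⟨_, rfl⟩
  have hNM : N < M := by
    by_contra h
    have h1 := hn.1 n le_rfl
    rw [hN _ (by omega)] at h1
    exact zero_ne_one h1
  obtain ⟨l, hl, hv, hpos, hex⟩ := exists_list_modeMonomial hm i hs n hM (M - N).toNat
  have eN : M - ((M - N).toNat : ℕ) = N := by omega
  rw [eN] at hv hpos hex
  refine ⟨⟨-n + l.length, posParts l⟩, ?_, ?_⟩
  · have hlt : ∀ u < l.length,
        onePosition m i ⟨-n + l.length, posParts l⟩ u = listPosition m M l u := by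
      intro u _
      rw [onePosition, listPosition, getD_sortedParts_posParts hl, hM]
      ring
    have hge : ∀ u, l.length ≤ u → onePosition m i ⟨-n + l.length, posParts l⟩ u =
        -i + 2 * m * (n + 1 + (u - l.length)) - 1 := by
      intro u hu
      rw [onePosition, getD_sortedParts_posParts hl, List.getD_eq_default _ _ hu, Nat.cast_zero]
      ring
    funext j
    have h1 := le_one_of_window hm hs j
    have h2 : partitionSeq m i ⟨-n + l.length, posParts l⟩ j ≤ 1 := by
      rw [partitionSeq]
      split_ifs <;> omega
    -- Both sequences take values in `{0, 1}`, so comparing supports suffices.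
    have h3 : partitionSeq m i ⟨-n + l.length, posParts l⟩ j ≠ 0 ↔ s j ≠ 0 := by
      rw [partitionSeq_ne_zero]
      constructor
      · rintro ⟨u, rfl⟩
        rcases lt_or_ge u l.length with hu | hu
        · rw [hlt u hu]
          exact (hpos u hu).2
        · rw [hge u hu, hn.1 _ (by omega)]
          exact one_ne_zero
      · intro hne
        rcases lt_or_ge j N with hjN | hjN
        · exact absurd (hN j hjN) hne
        rcases lt_or_ge j M with hjM | hjM
        · obtain ⟨u, hu, rfl⟩ := hex j hjN hjM hne
          exact ⟨u, hlt u hu⟩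
        · have hd : (2 * m : ℤ) ∣ j + i + 1 := by
            by_contra hd
            exact hne (hn.2 j (by omega) hd)
          obtain ⟨k, hk⟩ := hd
          have hkn : n < k := by
            have : (2 * m : ℤ) * n < 2 * m * k := by omega
            exact lt_of_mul_lt_mul_left this (by positivity)
          -- The one for `k = n` sits at `M - 1`, inside the list, so the ones from `M` on begin
          -- with `k = n + 1` at index `l.length`.
          refine ⟨(l.length + (k - n - 1)).toNat, ?_⟩
          rw [hge _ (by omega), Int.toNat_of_nonneg (by omega)]
          have e : n + 1 + (l.length + (k - n - 1) - l.length : ℤ) = k := by ring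
          rw [e]
          omega
    omega
  · rw [← hM, hv, fockVector_sortedParts_posParts m hl]

/-- The bijection between partitions with a charge and admissible sequences. -/
def partitionEquiv {m : ℕ} (hm : 0 < m) (i : ℕ) :
    (Σ _ : ℤ, Multiset ℕ+) ≃ {s : ℤ → ℕ // IsAdmissible m i s} :=
  Equiv.ofBijective (fun x => ⟨partitionSeq m i x, partitionSeq_isAdmissible hm i x⟩)
    ⟨fun _ _ h => partitionSeq_injective hm i (congrArg Subtype.val h), by
      rintro ⟨s, ⟨n, hn⟩, ⟨N, hN⟩, hs⟩
      obtain ⟨x, hx, _⟩ := exists_partition_modeMonomial hm i hs hn hN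
      exact ⟨x, Subtype.ext hx⟩⟩

end LatticeVA

end

theorem mainTheorem8 (m : ℕ) (hm : 0 < m) (i : ℕ) (hi : i < 2 * m) :
    (∀ j k : ℤ, Commute (LatticeVA.mode m i j) (LatticeVA.mode m i k)) ∧
    ∃ b : Module.Basis {s : ℤ → ℕ // LatticeVA.IsAdmissible m i s} ℂ
        (LatticeVA.LatticeModule m i),
      ∀ (s : {s : ℤ → ℕ // LatticeVA.IsAdmissible m i s}) (n N : ℤ),
        LatticeVA.PeriodicFrom m i s.1 n → (∀ j < N, s.1 j = 0) →
          b s = LatticeVA.modeMonomial m i s.1 N (-i + 2 * m * n)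
            (LatticeVA.extremalVector m i n) := by
  refine ⟨LatticeVA.mode_commute m i, ?_⟩
  obtain ⟨b, hb⟩ := LatticeVA.exists_basis_fockVector hm i
  refine ⟨b.reindex (LatticeVA.partitionEquiv hm i), fun s n N hn hN => ?_⟩
  obtain ⟨x, hx, hv⟩ := LatticeVA.exists_partition_modeMonomial hm i s.2.2.2 hn hN
  have hs : s = LatticeVA.partitionEquiv hm i x := Subtype.ext hx.symm
  rw [hv, Module.Basis.reindex_apply, hs, Equiv.symm_apply_apply, hb]
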